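/- Let $G$ be a locally compact second countable (Hausdorff) group, $H\subset G$ a closed subgroup, $\mu_G,\mu_H$ left Haar measures and $\Delta_G,\Delta_H$ the modular functions, normalised by $\mu(Eg)=\Delta(g)\mu(E)$. Put $\rho(h)=\Delta_H(h)/\Delta_G(h)$ for $h\in H$. Let $\pi$ be a strongly continuous unitary representation of $G$ on a separable complex Hilbert space $\mathcal H$ and $\sigma$ one of $H$ on a separable complex Hilbert space $\mathcal K$. Let $\mathcal G_\pi=\mathrm{span}\{\int_G f(g)\pi(g)u\,d\mu_G(g) : f\in C_c(G),\,u\in\mathcal H\}$ be the Gårding domain of $\pi$. A *weight function* is a continuous $\theta:G\to[0,\infty)$ such that $\int_H\theta(gh)\,d\mu_H(h)=1$ for all $g\in G$ and $CH\cap\operatorname{supp}\theta$ is compact for every compact $C\subset G$. Given such a $\theta$, $\mathcal H^{\rm ind}_\sigma$ is the space of classes of $\mu_G$-measurable $F:G\to\mathcal K$ such that for each $h\in H$, $F(gh)=\sqrt{\rho(h)}\,\sigma(h^{-1})F(g)$ for $\mu_G$-almost all $g$, and $\|F\|^2=\int_G\|F(g)\|^2\theta(g)\,d\mu_G(g)<\infty$;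 $G$ acts on it by $(\mathrm{ind}_aF)(g)=F(a^{-1}g)$ (the representation induced by $\sigma$). For a linear map $A:\mathcal G_\pi\to\mathcal K$ consider the conditions, with $v$ ranging over $\mathcal G_\pi$: * (S) $\sigma(h)Av=\sqrt{\rho(h)}\,A\pi(h)v$ for all $h\in H$ and all $v$; * (Q) there is $\beta>0$ with $\int_G\|A\pi(g^{-1})v\|^2\theta(g)\,d\mu_G(g)\le\beta\|v\|^2$ for all $v$; * (F) there are $0<\alpha\le\beta$ with $\alpha\|v\|^2\le\int_G\|A\pi(g^{-1})v\|^2\theta(g)\,d\mu_G(g)\le\beta\|v\|^2$ for all $v$; * (T) $\int_G\|A\pi(g^{-1})v\|^2\theta(g)\,d\mu_G(g)=\|v\|^2$ for all $v$. $A$ is *admissible for $\pi$ modulo $(H,\sigma)$* if (S) and (Q) hold and $g\mapsto A\pi(g^{-1})v$ is $\mu_G$-measurable for every $v$. Its *wavelet transform* $W_A$ is the unique bounded operator $\mathcal H\to\mathcal H^{\rm ind}_\sigma$ with $(W_Av)(g)=A\pi(g^{-1})v$ for $v\in\mathcal G_\pi$; it intertwines $\pi$ and $\mathrm{ind}$.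 The representation $\pi$ is *square-integrable modulo $(H,\sigma)$* if the following equivalent conditions hold: $\pi$ is equivalent to a sub-representation of $\mathrm{ind}$; some admissible map satisfies (T); some admissible map satisfies (F). **Corollary.** Let $A:\mathcal H\to\mathcal K$ be a bounded operator whose restriction to $\mathcal G_\pi$ satisfies (S). Then: 1. If $A\neq0$, then $G/H$ has a non-zero $G$-invariant Radon measure and $\Delta_G(h)=\Delta_H(h)$ for all $h\in H$. Moreover, for every weight function $\theta$: 2. If $A|_{\mathcal G_\pi}$ satisfies (Q), then $A|_{\mathcal G_\pi}$ is admissible, $W_A$ exists, is unique and intertwines $\pi$ with $\mathrm{ind}$, and for every $v\in\mathcal H$ (not only $v\in\mathcal G_\pi$) the element $W_Av$ of $\mathcal H^{\rm ind}_\sigma$ is represented by the continuous function $g\mapsto A\pi(g^{-1})v$. 3. If $A|_{\mathcal G_\pi}$ satisfies (F), then $\pi$ is square-integrable modulo $(H,\sigma)$ and modulo $(H,\pi|_H)$. -/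

import Mathlib

open MeasureTheory Measure Function
open scoped NNReal ENNReal Pointwise

namespace SqIntModSubgroup

/-! ### Unitary representations and the Gårding domain -/

/-- A strongly continuous unitary representation of `G` on `E`. -/
structure UnitaryRep (G E : Type*) [Group G] [TopologicalSpace G]
    [NormedAddCommGroup E] [InnerProductSpace ℂ E] where
  toHom : G →* (E ≃ₗᵢ[ℂ] E)
  continuous_apply : ∀ v : E, Continuous fun g => toHom g v

section Rep

variable {G E : Type*} [Group G] [TopologicalSpace G]
  [NormedAddCommGroup E] [InnerProductSpace ℂ E]

instance : CoeFun (UnitaryRep G E) (fun _ => G → E ≃ₗᵢ[ℂ] E) := ⟨fun π => π.toHom⟩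

/-- The restriction of a representation to a subgroup. -/
def UnitaryRep.restrict (π : UnitaryRep G E) (H : Subgroup G) : UnitaryRep H E where
  toHom := π.toHom.comp H.subtype
  continuous_apply v := (π.continuous_apply v).comp continuous_subtype_val

variable [MeasurableSpace G]

/-- `π(f) u = ∫ f(g) π(g) u dμ(g)`. -/
noncomputable def UnitaryRep.smear (π : UnitaryRep G E) (μ : Measure G) (f : G → ℂ) (u : E) : E :=
  ∫ g, f g • π g u ∂μ

/-- The Gårding domain: the span of the vectors `π(f) u` with `f ∈ C_c(G)` and `u ∈ E`. -/
def UnitaryRep.garding (π : UnitaryRep G E) (μ : Measure G) : Submodule ℂ E :=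
  Submodule.span ℂ {w | ∃ f : G → ℂ, Continuous f ∧ HasCompactSupport f ∧ ∃ u : E,
    w = π.smear μ f u}

theorem UnitaryRep.apply_mem_garding [IsTopologicalGroup G] [BorelSpace G] [CompleteSpace E]
    (π : UnitaryRep G E) (μ : Measure G) [μ.IsMulLeftInvariant] (g : G) {v : E}
    (hv : v ∈ π.garding μ) : π g v ∈ π.garding μ := by
  induction hv using Submodule.span_induction with
  | mem w hw =>
    obtain ⟨f, hf, hfc, u, rfl⟩ := hw
    refine Submodule.subset_span ⟨fun x => f (g⁻¹ * x), by fun_prop,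
      hfc.comp_homeomorph (Homeomorph.mulLeft g⁻¹), u, ?_⟩
    have h1 : π g (π.smear μ f u) = ∫ x, f x • π (g * x) u ∂μ := by
      have h2 := (π g).toContinuousLinearEquiv.integral_comp_comm (μ := μ) (fun x => f x • π x u)
      have h3 : π g (π.smear μ f u) = ∫ x, π g (f x • π x u) ∂μ := h2.symm
      rw [h3]
      congr 1
      ext x
      rw [map_smul, map_mul]
      rfl
    rw [h1]
    have h4 := integral_mul_left_eq_self (μ := μ) (fun x => f (g⁻¹ * x) • π x u) g
    simpa [UnitaryRep.smear] using h4
  | zero => simp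
  | add x y _ _ hx hy => rw [map_add]; exact add_mem hx hy
  | smul c x _ hx => rw [map_smul]; exact Submodule.smul_mem _ c hx

/-- The action of `G` on the Gårding domain. -/
noncomputable def UnitaryRep.gardingAct [IsTopologicalGroup G] [BorelSpace G] [CompleteSpace E]
    (π : UnitaryRep G E) (μ : Measure G) [μ.IsMulLeftInvariant] (g : G) :
    π.garding μ →ₗ[ℂ] π.garding μ :=
  ((π g).toLinearEquiv.toLinearMap).restrict fun _ hv => π.apply_mem_garding μ g hv

end Rep

/-! ### Modular functions -/

section Modular

variable {G : Type*} [Group G] [TopologicalSpace G] [IsTopologicalGroup G] [LocallyCompactSpace G]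

/-- The modular function `Δ` of `G`, normalised by `μ(E g) = Δ(g) μ(E)` for a left Haar measure
`μ`, i.e. `∫ f(x g⁻¹) dμ(x) = Δ(g) ∫ f dμ`. (Mathlib's `modularCharacter` is the inverse of it.) -/
noncomputable def modFun (g : G) : ℝ≥0 := (modularCharacter g)⁻¹

/-- `ρ(h) = Δ_H(h) / Δ_G(h)` for `h ∈ H`. -/
noncomputable def modRatio (H : Subgroup G) [LocallyCompactSpace H] (h : H) : ℝ≥0 :=
  modFun h / modFun (h : G)

variable [SecondCountableTopology G] [T2Space G] [MeasurableSpace G] [BorelSpace G]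

theorem lintegral_comp_mul_right (μ : Measure G) [μ.IsHaarMeasure] (f : G → ℝ≥0∞) (g : G) :
    ∫⁻ x, f (x * g) ∂μ = (modularCharacter g : ℝ≥0∞) * ∫⁻ x, f x ∂μ := by
  have h : map (· * g) μ = modularCharacter g • μ := map_right_mul_eq_modularCharacterFun_smul μ g
  have h2 : ∫⁻ x, f (x * g) ∂μ = ∫⁻ x, f x ∂(map (· * g) μ) :=
    (lintegral_map_equiv f (MeasurableEquiv.mulRight g)).symm
  rw [h2, h, lintegral_smul_measure]
  rfl

theorem modularCharacter_ne_zero (g : G) : modularCharacter g ≠ 0 :=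
  (modularCharacterFun_pos g).ne'

theorem exists_lintegral_pos (μ : Measure G) [μ.IsHaarMeasure] :
    ∃ k : G → ℝ≥0∞, Measurable k ∧ ∫⁻ x, k x ∂μ ≠ 0 ∧ ∫⁻ x, k x ∂μ ≠ ∞ := by
  obtain ⟨K, hK, hK1⟩ := exists_compact_mem_nhds (1 : G)
  refine ⟨K.indicator 1, measurable_one.indicator hK.measurableSet, ?_, ?_⟩ <;>
    rw [lintegral_indicator_one hK.measurableSet]
  · exact (measure_pos_of_mem_nhds μ hK1).ne'
  · exact hK.measure_lt_top.ne

theorem measurable_modularCharacter : Measurable fun g : G => (modularCharacter g : ℝ≥0∞) := by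
  obtain ⟨k, hk, h0, h1⟩ := exists_lintegral_pos (haar : Measure G)
  have : (fun g : G => (modularCharacter g : ℝ≥0∞)) =
      fun g => (∫⁻ x, k (x * g) ∂haar) / ∫⁻ x, k x ∂haar := by
    ext g
    rw [lintegral_comp_mul_right, ENNReal.mul_div_cancel_right h0 h1]
  rw [this]
  refine Measurable.div_const ?_ _
  exact Measurable.lintegral_prod_left' (f := fun z : G × G => k (z.1 * z.2)) (by fun_prop)

/-- `∫ Δ(x)⁻¹ f(x⁻¹) dμ(x) = ∫ f dμ`. -/
theorem lintegral_modular_inv (μ : Measure G) [μ.IsHaarMeasure] {f : G → ℝ≥0∞}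
    (hf : Measurable f) :
    ∫⁻ x, (modularCharacter x : ℝ≥0∞) * f x⁻¹ ∂μ = ∫⁻ x, f x ∂μ := by
  obtain ⟨k, hk, h0, h1⟩ := exists_lintegral_pos μ
  have key : ∀ m : G → ℝ≥0∞, Measurable m → (∀ x, m x⁻¹ * m x = 1) →
      (∀ x, ∫⁻ y, k (y * x) ∂μ = m x * ∫⁻ y, k y ∂μ) →
      ∫⁻ x, m x * f x⁻¹ ∂μ = ∫⁻ x, f x ∂μ := by
    intro m hm hinv hmk
    suffices h : (∫⁻ x, k x ∂μ) * ∫⁻ x, m x * f x⁻¹ ∂μ = (∫⁻ x, k x ∂μ) * ∫⁻ x, f x ∂μ from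
      (ENNReal.mul_right_inj h0 h1).1 h
    calc (∫⁻ x, k x ∂μ) * ∫⁻ y, m y * f y⁻¹ ∂μ
        = ∫⁻ x, ∫⁻ y, k x * (m (x⁻¹ * y) * f (x⁻¹ * y)⁻¹) ∂μ ∂μ := by
          rw [← lintegral_mul_const _ hk]
          congr 1; ext x
          rw [lintegral_const_mul _ (by fun_prop),
            lintegral_mul_left_eq_self (fun y => m y * f y⁻¹) x⁻¹]
      _ = ∫⁻ y, ∫⁻ x, k x * (m (x⁻¹ * y) * f (x⁻¹ * y)⁻¹) ∂μ ∂μ :=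
          lintegral_lintegral_swap (Measurable.aemeasurable (by unfold Function.uncurry; fun_prop))
      _ = ∫⁻ y, ∫⁻ x, k (y * x) * (m x⁻¹ * f x) ∂μ ∂μ := by
          congr 1; ext y
          rw [← lintegral_mul_left_eq_self _ y]
          simp [mul_assoc]
      _ = ∫⁻ x, ∫⁻ y, k (y * x) * (m x⁻¹ * f x) ∂μ ∂μ :=
          lintegral_lintegral_swap (Measurable.aemeasurable (by unfold Function.uncurry; fun_prop))
      _ = ∫⁻ x, (∫⁻ y, k y ∂μ) * f x ∂μ := by
          congr 1; ext x
          rw [lintegral_mul_const _ (by fun_prop), hmk]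
          calc _ = (m x⁻¹ * m x) * ((∫⁻ y, k y ∂μ) * f x) := by ring
            _ = _ := by rw [hinv, one_mul]
      _ = _ := lintegral_const_mul _ hf
  refine key _ measurable_modularCharacter (fun x => ?_) fun x => lintegral_comp_mul_right μ k x
  rw [← ENNReal.coe_mul, ← map_mul, inv_mul_cancel, map_one, ENNReal.coe_one]

end Modular

/-! ### The weight function `θ` and the induced representation -/

section Induced

variable {G : Type*} [Group G] [TopologicalSpace G] [MeasurableSpace G]

/-- `θ : G → [0, ∞)` is continuous, `∫_H θ(gh) dμ_H(h) = 1` for every `g ∈ G`, and `KH ∩ supp θ`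
is compact for every compact `K`. -/
structure IsTheta (H : Subgroup G) (μH : Measure H) (θ : G → ℝ) : Prop where
  continuous : Continuous θ
  nonneg : ∀ g, 0 ≤ θ g
  integral_eq_one : ∀ g : G, ∫ h : H, θ (g * h) ∂μH = 1
  isCompact_inter : ∀ K : Set G, IsCompact K → IsCompact (K * (H : Set G) ∩ tsupport θ)

/-- The measure `θ μ_G`. -/
noncomputable def thetaMeasure (μG : Measure G) (θ : G → ℝ) : Measure G :=
  μG.withDensity fun g => ENNReal.ofReal (θ g)

variable [IsTopologicalGroup G] [LocallyCompactSpace G] {H : Subgroup G} [LocallyCompactSpace H]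
  {K : Type*} [NormedAddCommGroup K] [InnerProductSpace ℂ K]

/-- The functions `F : G → K` whose classes form the space of the induced representation:
`F` is `μ_G`-measurable; for each `h ∈ H`, `F(gh) = √ρ(h) σ(h⁻¹) F(g)` for almost all `g`; and
`∫ ‖F‖² θ dμ_G < ∞`. -/
structure IsInduced (μG : Measure G) (θ : G → ℝ) (σ : UnitaryRep H K) (F : G → K) : Prop where
  aestronglyMeasurable : AEStronglyMeasurable F μG
  covariant : ∀ h : H, ∀ᵐ g ∂μG,
    F (g * h) = ((√(modRatio H h : ℝ) : ℝ) : ℂ) • σ h⁻¹ (F g)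
  lintegral_lt_top : ∫⁻ g, ‖F g‖ₑ ^ 2 ∂(thetaMeasure μG θ) < ∞

variable {μG : Measure G} {θ : G → ℝ} {σ : UnitaryRep H K} {F F' : G → K}

theorem IsInduced.memLp (hF : IsInduced μG θ σ F) : MemLp F 2 (thetaMeasure μG θ) := by
  refine ⟨hF.aestronglyMeasurable.mono_ac (withDensity_absolutelyContinuous _ _), ?_⟩
  rw [eLpNorm_lt_top_iff_lintegral_rpow_enorm_lt_top (by norm_num) (by norm_num)]
  simpa using hF.lintegral_lt_top

theorem IsInduced.add (hF : IsInduced μG θ σ F) (hF' : IsInduced μG θ σ F') :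
    IsInduced μG θ σ (F + F') where
  aestronglyMeasurable := hF.aestronglyMeasurable.add hF'.aestronglyMeasurable
  covariant h := by
    filter_upwards [hF.covariant h, hF'.covariant h] with g h1 h2
    simp [h1, h2]
  lintegral_lt_top := by
    have h := (hF.memLp.add hF'.memLp).2
    rw [eLpNorm_lt_top_iff_lintegral_rpow_enorm_lt_top (by norm_num) (by norm_num)] at h
    simpa using h

theorem IsInduced.smul (c : ℂ) (hF : IsInduced μG θ σ F) : IsInduced μG θ σ (c • F) where
  aestronglyMeasurable := hF.aestronglyMeasurable.const_smul c
  covariant h := by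
    filter_upwards [hF.covariant h] with g h1
    simp [h1, smul_comm c]
  lintegral_lt_top := by
    have h := (hF.memLp.const_smul c).2
    rw [eLpNorm_lt_top_iff_lintegral_rpow_enorm_lt_top (by norm_num) (by norm_num)] at h
    simpa using h

theorem IsInduced.zero : IsInduced μG θ σ (0 : G → K) where
  aestronglyMeasurable := aestronglyMeasurable_zero
  covariant h := by simp
  lintegral_lt_top := by simp

variable (μG θ σ)

/-- The space of the induced representation, as a subspace of `L²(G, θ μ_G; K)`. -/
def Ind : Submodule ℂ (Lp K 2 (thetaMeasure μG θ)) where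
  carrier := {u | ∃ F : G → K, IsInduced μG θ σ F ∧ u =ᵐ[thetaMeasure μG θ] F}
  add_mem' := by
    rintro u v ⟨F, hF, hu⟩ ⟨F', hF', hv⟩
    exact ⟨F + F', hF.add hF', (Lp.coeFn_add u v).trans (hu.add hv)⟩
  zero_mem' := ⟨0, IsInduced.zero, Lp.coeFn_zero _ _ _⟩
  smul_mem' := by
    rintro c u ⟨F, hF, hu⟩
    exact ⟨c • F, hF.smul c, (Lp.coeFn_smul c u).trans (hu.const_smul c)⟩

variable {μG θ σ}

/-- The class of a function in the space of the induced representation. -/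
noncomputable def IsInduced.toInd (hF : IsInduced μG θ σ F) : Ind μG θ σ :=
  ⟨hF.memLp.toLp F, F, hF, hF.memLp.coeFn_toLp⟩

theorem exists_indRep (u : Ind μG θ σ) : ∃ (F : G → K) (hF : IsInduced μG θ σ F),
    u = hF.toInd := by
  obtain ⟨u, F, hF, hu⟩ := u
  exact ⟨F, hF, Subtype.ext (Lp.ext (hu.trans hF.memLp.coeFn_toLp.symm))⟩

/-- A function representing an element of the space of the induced representation. -/
noncomputable def indRep (u : Ind μG θ σ) : G → K := (exists_indRep u).choose

theorem isInduced_indRep (u : Ind μG θ σ) : IsInduced μG θ σ (indRep u) :=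
  (exists_indRep u).choose_spec.choose

theorem toInd_indRep (u : Ind μG θ σ) : (isInduced_indRep u).toInd = u :=
  (exists_indRep u).choose_spec.choose_spec.symm

theorem IsInduced.norm_toInd (hF : IsInduced μG θ σ F) :
    ‖hF.toInd‖ = ((∫⁻ g, ‖F g‖ₑ ^ 2 ∂(thetaMeasure μG θ)) ^ (1 / 2 : ℝ)).toReal := by
  have h1 : ‖hF.toInd‖ = (eLpNorm F 2 (thetaMeasure μG θ)).toReal := Lp.norm_toLp F hF.memLp
  rw [h1, eLpNorm_eq_lintegral_rpow_enorm_toReal (by norm_num) (by norm_num)]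
  simp

variable [SecondCountableTopology G] [T2Space G] [BorelSpace G]

theorem lintegral_covariant_swap [μG.IsHaarMeasure] {T T' N : G → ℝ≥0∞} (_hT : Measurable T)
    (_hT' : Measurable T') (h : H)
    (hNc : ∀ᵐ g ∂μG, N (g * (h⁻¹ : H)) = (modRatio H h⁻¹ : ℝ≥0∞) * N g) :
    ∫⁻ g, T g * N g * T' (g * h) ∂μG =
      ∫⁻ g, T' g * N g * ((modularCharacter h : ℝ≥0∞) * T (g * (h⁻¹ : H))) ∂μG := by
  have h1 := lintegral_comp_mul_right μG (fun g => T g * N g * T' (g * h)) ((h⁻¹ : H) : G)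
  have h2 : ∫⁻ g, T g * N g * T' (g * h) ∂μG = (modularCharacter (h : G) : ℝ≥0∞) *
      ∫⁻ g, T (g * (h⁻¹ : H)) * N (g * (h⁻¹ : H)) * T' g ∂μG := by
    simp only [Subgroup.coe_inv, inv_mul_cancel_right] at h1 ⊢
    rw [h1, ← mul_assoc, ← ENNReal.coe_mul, ← map_mul, mul_inv_cancel, map_one,
      ENNReal.coe_one, one_mul]
  rw [h2, ← lintegral_const_mul' _ _ ENNReal.coe_ne_top]
  refine lintegral_congr_ae ?_
  filter_upwards [hNc] with g hg
  rw [hg]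
  have h3 : (modularCharacter (h : G) : ℝ≥0∞) * (modRatio H h⁻¹ : ℝ≥0∞) =
      (modularCharacter h : ℝ≥0∞) := by
    rw [← ENNReal.coe_mul]
    congr 1
    have e1 : modularCharacter ((h⁻¹ : H) : G) * modularCharacter (h : G) = 1 := by
      rw [← map_mul, ← Subgroup.coe_mul, inv_mul_cancel, Subgroup.coe_one, map_one]
    have e2 : modularCharacter h⁻¹ * modularCharacter h = 1 := by
      rw [← map_mul, inv_mul_cancel, map_one]
    have e3 := eq_inv_of_mul_eq_one_left e1
    have e4 := eq_inv_of_mul_eq_one_left e2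
    have hne := modularCharacter_ne_zero (h : G)
    rw [modRatio, modFun, modFun, e3, e4, inv_inv, inv_inv, div_eq_mul_inv, mul_comm,
      mul_assoc, inv_mul_cancel₀ hne, mul_one]
  calc _ = ((modularCharacter (h : G) : ℝ≥0∞) * (modRatio H h⁻¹ : ℝ≥0∞)) *
        (T (g * (h⁻¹ : H)) * N g * T' g) := by ring
    _ = _ := by rw [h3]; ring

theorem lintegral_covariant_eq [μG.IsHaarMeasure] {μH : Measure H} [μH.IsHaarMeasure]
    {T T' N : G → ℝ≥0∞} (hT : Measurable T) (hT' : Measurable T')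
    (J : ∀ g : G, ∫⁻ h : H, T (g * h) ∂μH = 1) (J' : ∀ g : G, ∫⁻ h : H, T' (g * h) ∂μH = 1)
    (hN : AEMeasurable N μG)
    (hNc : ∀ h : H, ∀ᵐ g ∂μG, N (g * h) = (modRatio H h : ℝ≥0∞) * N g) :
    ∫⁻ g, T g * N g ∂μG = ∫⁻ g, T' g * N g ∂μG := by
  have : SecondCountableTopology H :=
    TopologicalSpace.Subtype.secondCountableTopology (H : Set G)
  have hN1 : AEMeasurable (fun z : G × H => N z.1) (μG.prod μH) := hN.comp_fst
  have h4 := measurable_modularCharacter (G := H)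
  have s1 : ∫⁻ g, T g * N g ∂μG = ∫⁻ g, ∫⁻ h : H, T g * N g * T' (g * h) ∂μH ∂μG := by
    congr 1; ext g
    rw [lintegral_const_mul _ (by fun_prop), J', mul_one]
  have s2 : ∫⁻ g, ∫⁻ h : H, T g * N g * T' (g * h) ∂μH ∂μG =
      ∫⁻ h : H, ∫⁻ g, T g * N g * T' (g * h) ∂μG ∂μH := by
    refine lintegral_lintegral_swap ?_
    have m1 : Measurable fun z : G × H => T z.1 := by fun_prop
    have m2 : Measurable fun z : G × H => T' (z.1 * z.2) := by fun_prop
    exact (m1.aemeasurable.mul hN1).mul m2.aemeasurable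
  have s3 : ∫⁻ h : H, ∫⁻ g, T g * N g * T' (g * h) ∂μG ∂μH = ∫⁻ h : H, ∫⁻ g, T' g * N g *
      ((modularCharacter h : ℝ≥0∞) * T (g * (h⁻¹ : H))) ∂μG ∂μH :=
    lintegral_congr fun h => lintegral_covariant_swap hT hT' h (hNc h⁻¹)
  have s4 : ∫⁻ h : H, ∫⁻ g, T' g * N g *
      ((modularCharacter h : ℝ≥0∞) * T (g * (h⁻¹ : H))) ∂μG ∂μH = ∫⁻ g, ∫⁻ h : H, T' g * N g *
      ((modularCharacter h : ℝ≥0∞) * T (g * (h⁻¹ : H))) ∂μH ∂μG := by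
    refine (lintegral_lintegral_swap ?_).symm
    have m1 : Measurable fun z : G × H => T' z.1 := by fun_prop
    have m2 : Measurable fun z : G × H => T (z.1 * (z.2⁻¹ : H)) := by fun_prop
    have m3 : Measurable fun z : G × H => (modularCharacter z.2 : ℝ≥0∞) :=
      h4.comp measurable_snd
    exact (m1.aemeasurable.mul hN1).mul (m3.mul m2).aemeasurable
  rw [s1, s2, s3, s4]
  congr 1; ext g
  have h5 : Measurable fun h : H => T (g * h) := by fun_prop
  have h6 : Measurable fun h : H => (modularCharacter h : ℝ≥0∞) * T (g * (h⁻¹ : H)) :=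
    h4.mul (h5.comp measurable_inv)
  rw [lintegral_const_mul _ h6, lintegral_modular_inv μH h5, J, mul_one]

theorem lintegral_ofReal_eq_one {μH : Measure H} {η : G → ℝ} (hη0 : ∀ g, 0 ≤ η g)
    (hη1 : ∀ g : G, ∫ h : H, η (g * h) ∂μH = 1) (g : G) :
    ∫⁻ h : H, ENNReal.ofReal (η (g * h)) ∂μH = 1 := by
  rw [← ofReal_integral_eq_lintegral_ofReal _ (Filter.Eventually.of_forall fun _ => hη0 _), hη1,
    ENNReal.ofReal_one]
  by_contra hni
  exact zero_ne_one ((integral_undef hni).symm.trans (hη1 g))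

/-- The norm of a covariant function does not depend on the choice of `θ`. -/
theorem lintegral_theta_eq [μG.IsHaarMeasure] {μH : Measure H} [μH.IsHaarMeasure] {θ θ' : G → ℝ}
    (hθc : Continuous θ) (hθ0 : ∀ g, 0 ≤ θ g) (hθ1 : ∀ g : G, ∫ h : H, θ (g * h) ∂μH = 1)
    (hθc' : Continuous θ') (hθ0' : ∀ g, 0 ≤ θ' g) (hθ1' : ∀ g : G, ∫ h : H, θ' (g * h) ∂μH = 1)
    {N : G → ℝ≥0∞} (hN : AEMeasurable N μG)
    (hNc : ∀ h : H, ∀ᵐ g ∂μG, N (g * h) = (modRatio H h : ℝ≥0∞) * N g) :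
    ∫⁻ g, N g ∂(thetaMeasure μG θ) = ∫⁻ g, N g ∂(thetaMeasure μG θ') := by
  have hm : Measurable fun g => ENNReal.ofReal (θ g) := by fun_prop
  have hm' : Measurable fun g => ENNReal.ofReal (θ' g) := by fun_prop
  unfold thetaMeasure
  rw [lintegral_withDensity_eq_lintegral_mul₀ hm.aemeasurable hN,
    lintegral_withDensity_eq_lintegral_mul₀ hm'.aemeasurable hN]
  exact lintegral_covariant_eq hm hm' (lintegral_ofReal_eq_one hθ0 hθ1)
    (lintegral_ofReal_eq_one hθ0' hθ1') hN hNc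

theorem IsInduced.enorm_sq_covariant (hF : IsInduced μG θ σ F) (h : H) :
    ∀ᵐ g ∂μG, ‖F (g * h)‖ₑ ^ 2 = (modRatio H h : ℝ≥0∞) * ‖F g‖ₑ ^ 2 := by
  filter_upwards [hF.covariant h] with g hg
  rw [hg, enorm_smul, mul_pow, LinearIsometryEquiv.enorm_map]
  congr 1
  rw [← ofReal_norm, Complex.norm_real, Real.norm_of_nonneg (Real.sqrt_nonneg _),
    ← ENNReal.ofReal_pow (Real.sqrt_nonneg _), Real.sq_sqrt (NNReal.coe_nonneg _),
    ENNReal.ofReal_coe_nnreal]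

variable [μG.IsHaarMeasure] {μH : Measure H} [μH.IsHaarMeasure]

theorem IsInduced.lintegral_translate (hθ : IsTheta H μH θ) (hF : IsInduced μG θ σ F) (a : G) :
    ∫⁻ g, ‖F (a⁻¹ * g)‖ₑ ^ 2 ∂(thetaMeasure μG θ) = ∫⁻ g, ‖F g‖ₑ ^ 2 ∂(thetaMeasure μG θ) := by
  have hθc := hθ.continuous
  have hN : AEMeasurable (fun g => ‖F g‖ₑ ^ 2) μG := hF.aestronglyMeasurable.enorm.pow_const 2
  have hN' : AEMeasurable (fun g => ‖F (a⁻¹ * g)‖ₑ ^ 2) μG :=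
    hN.comp_quasiMeasurePreserving (measurePreserving_mul_left μG a⁻¹).quasiMeasurePreserving
  rw [lintegral_theta_eq (μH := μH) (θ' := fun g => θ (a * g)) hθ.continuous hθ.nonneg
    hθ.integral_eq_one (by fun_prop) (fun g => hθ.nonneg _)
    (fun g => by simpa [mul_assoc] using hθ.integral_eq_one (a * g)) hN hF.enorm_sq_covariant]
  unfold thetaMeasure
  rw [lintegral_withDensity_eq_lintegral_mul₀ (by fun_prop) hN,
    lintegral_withDensity_eq_lintegral_mul₀ (by fun_prop) hN', ← lintegral_mul_left_eq_self _ a]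
  simp

theorem IsInduced.translate (hθ : IsTheta H μH θ) (hF : IsInduced μG θ σ F) (a : G) :
    IsInduced μG θ σ fun g => F (a⁻¹ * g) where
  aestronglyMeasurable := hF.aestronglyMeasurable.comp_quasiMeasurePreserving
    (measurePreserving_mul_left μG a⁻¹).quasiMeasurePreserving
  covariant h := by
    have := (measurePreserving_mul_left μG a⁻¹).quasiMeasurePreserving.ae (hF.covariant h)
    simpa [mul_assoc] using this
  lintegral_lt_top := by
    rw [hF.lintegral_translate hθ a]
    exact hF.lintegral_lt_top

theorem IsInduced.toInd_add (hF : IsInduced μG θ σ F) (hF' : IsInduced μG θ σ F') :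
    (hF.add hF').toInd = hF.toInd + hF'.toInd := rfl

theorem IsInduced.toInd_smul (c : ℂ) (hF : IsInduced μG θ σ F) :
    (hF.smul c).toInd = c • hF.toInd := rfl

theorem IsInduced.norm_translate (hθ : IsTheta H μH θ) (hF : IsInduced μG θ σ F) (a : G) :
    ‖(hF.translate hθ a).toInd‖ = ‖hF.toInd‖ := by
  rw [norm_toInd, norm_toInd, hF.lintegral_translate hθ a]

/-- Translation is well defined on classes. -/
theorem IsInduced.translate_congr (hθ : IsTheta H μH θ) (hF : IsInduced μG θ σ F)
    (hF' : IsInduced μG θ σ F') (a : G) (h : hF.toInd = hF'.toInd) :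
    (hF.translate hθ a).toInd = (hF'.translate hθ a).toInd := by
  have hG := hF.add (hF'.smul (-1))
  have h0 : hG.toInd = 0 := by
    have : hG.toInd = hF.toInd + (-1 : ℂ) • hF'.toInd := rfl
    rw [this, h]; simp
  have h1 := hG.norm_translate hθ a
  rw [h0, norm_zero, norm_eq_zero] at h1
  have h2 : (hG.translate hθ a).toInd =
    (hF.translate hθ a).toInd + (-1 : ℂ) • (hF'.translate hθ a).toInd := rfl
  rw [h2, neg_one_smul, ← sub_eq_add_neg, sub_eq_zero] at h1
  exact h1

/-- The operator `(ind_a F)(g) = F(a⁻¹ g)`. -/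
noncomputable def indIsometry (σ : UnitaryRep H K) (hθ : IsTheta H μH θ) (a : G) :
    Ind μG θ σ →ₗᵢ[ℂ] Ind μG θ σ where
  toFun u := ((isInduced_indRep u).translate hθ a).toInd
  map_add' u v := by
    refine IsInduced.translate_congr hθ (isInduced_indRep (u + v))
      ((isInduced_indRep u).add (isInduced_indRep v)) a ?_
    rw [IsInduced.toInd_add (isInduced_indRep u) (isInduced_indRep v), toInd_indRep, toInd_indRep,
      toInd_indRep]
  map_smul' c u := by
    refine IsInduced.translate_congr hθ (isInduced_indRep (c • u)) ((isInduced_indRep u).smul c) a ?_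
    rw [IsInduced.toInd_smul c (isInduced_indRep u), toInd_indRep, toInd_indRep]
  norm_map' u := by
    have := (isInduced_indRep u).norm_translate hθ a
    rw [toInd_indRep] at this
    exact this

theorem indIsometry_toInd (hθ : IsTheta H μH θ) (a : G) (hF : IsInduced μG θ σ F) :
    indIsometry σ hθ a hF.toInd = (hF.translate hθ a).toInd :=
  IsInduced.translate_congr hθ _ hF a (toInd_indRep _)

theorem indIsometry_one (hθ : IsTheta H μH θ) (u : Ind μG θ σ) :
    indIsometry σ hθ 1 u = u := by
  obtain ⟨F, hF, rfl⟩ := (exists_indRep u)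
  rw [indIsometry_toInd]
  simp

theorem indIsometry_mul (hθ : IsTheta H μH θ) (a b : G) (u : Ind μG θ σ) :
    indIsometry σ hθ (a * b) u = indIsometry σ hθ a (indIsometry σ hθ b u) := by
  obtain ⟨F, hF, rfl⟩ := (exists_indRep u)
  rw [indIsometry_toInd, indIsometry_toInd, indIsometry_toInd]
  simp [mul_assoc]

/-- The representation `ind` of `G` induced by `σ`, acting by unitary operators on `Ind`. -/
noncomputable def ind (σ : UnitaryRep H K) (hθ : IsTheta H μH θ) :
    G →* (Ind μG θ σ ≃ₗᵢ[ℂ] Ind μG θ σ) where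
  toFun a :=
    { toLinearEquiv := LinearEquiv.ofLinearMap (indIsometry σ hθ a).toLinearMap
        (indIsometry σ hθ a⁻¹).toLinearMap
        (by ext1 u; simp [← indIsometry_mul, indIsometry_one])
        (by ext1 u; simp [← indIsometry_mul, indIsometry_one])
      norm_map' := fun u => (indIsometry σ hθ a).norm_map u }
  map_one' := by ext1 u; exact indIsometry_one hθ u
  map_mul' a b := by ext1 u; exact indIsometry_mul hθ a b u

/-! ### Admissible maps and square-integrability modulo `(H, σ)` -/

variable {E : Type*} [NormedAddCommGroup E] [InnerProductSpace ℂ E] [CompleteSpace E]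
  {π : UnitaryRep G E}

/-- The function `(W_A v)(g) = A π(g⁻¹) v`, for `v` in the Gårding domain of `π`. -/
noncomputable def orbitMap (A : π.garding μG →ₗ[ℂ] K) (v : π.garding μG) (g : G) : K :=
  A (π.gardingAct μG g⁻¹ v)

/-- Semi-invariance: `σ(h) A v = √ρ(h) A π(h) v` for all `h ∈ H` and `v` in the Gårding domain. -/
def IsSemiInvariant (σ : UnitaryRep H K) (A : π.garding μG →ₗ[ℂ] K) : Prop :=
  ∀ (h : H) (v : π.garding μG),
    σ h (A v) = ((√(modRatio H h : ℝ) : ℝ) : ℂ) • A (π.gardingAct μG (h : G) v)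

/-- `∫ ‖A π(g⁻¹) v‖² θ(g) dμ_G(g)`, with value in `[0, ∞]`. -/
noncomputable def energy (θ : G → ℝ) (A : π.garding μG →ₗ[ℂ] K) (v : π.garding μG) : ℝ≥0∞ :=
  ∫⁻ g, ‖orbitMap A v g‖ₑ ^ 2 ∂(thetaMeasure μG θ)

/-- `∫ ‖A π(g⁻¹) v‖² θ(g) dμ_G(g) ≤ β ‖v‖²` on the Gårding domain, for some `β > 0`. -/
def IsSquareBounded (θ : G → ℝ) (A : π.garding μG →ₗ[ℂ] K) : Prop :=
  ∃ β : ℝ, 0 < β ∧ ∀ v : π.garding μG, energy θ A v ≤ ENNReal.ofReal (β * ‖v‖ ^ 2)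

/-- `α ‖v‖² ≤ ∫ ‖A π(g⁻¹) v‖² θ(g) dμ_G(g) ≤ β ‖v‖²` on the Gårding domain, for some
`0 < α ≤ β`. -/
def IsFrame (θ : G → ℝ) (A : π.garding μG →ₗ[ℂ] K) : Prop :=
  ∃ α β : ℝ, 0 < α ∧ α ≤ β ∧ ∀ v : π.garding μG,
    ENNReal.ofReal (α * ‖v‖ ^ 2) ≤ energy θ A v ∧ energy θ A v ≤ ENNReal.ofReal (β * ‖v‖ ^ 2)

/-- `∫ ‖A π(g⁻¹) v‖² θ(g) dμ_G(g) = ‖v‖²` on the Gårding domain. -/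
def IsTightFrame (θ : G → ℝ) (A : π.garding μG →ₗ[ℂ] K) : Prop :=
  ∀ v : π.garding μG, energy θ A v = ENNReal.ofReal (‖v‖ ^ 2)

/-- `A` is an admissible map for `π` modulo `(H, σ)`. -/
structure IsAdmissible (θ : G → ℝ) (σ : UnitaryRep H K) (A : π.garding μG →ₗ[ℂ] K) : Prop where
  semiInvariant : IsSemiInvariant σ A
  aestronglyMeasurable : ∀ v : π.garding μG, AEStronglyMeasurable (orbitMap A v) μG
  squareBounded : IsSquareBounded θ A

/-- `W` is a bounded extension of `v ↦ W_A v` from the Gårding domain to the whole space. -/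
def IsWaveletTransform (A : π.garding μG →ₗ[ℂ] K) (W : E →L[ℂ] Ind μG θ σ) : Prop :=
  ∀ v : π.garding μG, ∃ hF : IsInduced μG θ σ (orbitMap A v), W (v : E) = hF.toInd

/-- `π` is equivalent to a sub-representation of `ind`: there is a linear isometry of `E` into the
space of `ind` (so onto a closed invariant subspace) that intertwines the two actions. -/
def IsSubrepOfInd (μG : Measure G) [μG.IsHaarMeasure] (π : UnitaryRep G E) (σ : UnitaryRep H K)
    (hθ : IsTheta H μH θ) : Prop :=
  ∃ W : E →ₗᵢ[ℂ] Ind μG θ σ, ∀ (g : G) (v : E), W (π g v) = ind σ hθ g (W v)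

/-- `π` is square-integrable modulo `(H, σ)`. The notion is given by any one of the three
conditions below, which are equivalent; all of them are required here, so that nothing depends on
the equivalence. -/
structure IsSquareIntegrableMod (μG : Measure G) [μG.IsHaarMeasure] (π : UnitaryRep G E)
    (σ : UnitaryRep H K) (hθ : IsTheta H μH θ) : Prop where
  subrep : IsSubrepOfInd μG π σ hθ
  tight : ∃ A : π.garding μG →ₗ[ℂ] K, IsAdmissible θ σ A ∧ IsTightFrame θ A
  frame : ∃ A : π.garding μG →ₗ[ℂ] K, IsAdmissible θ σ A ∧ IsFrame θ A

end Induced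

end SqIntModSubgroup

/-!
The Gårding domain is dense and `A` is bounded, so (S) holds on all of `E`. As `π` and `σ` act by
isometries, it gives `‖A‖ = √ρ(h) ‖A‖` for `h ∈ H`; hence `ρ = 1` as soon as `A ≠ 0`.

Write `f♭(g) = ∫_H f(gh) dμ_H(h)`. If `ρ = 1`, then `∫ f k♭ = ∫ k f♭` over `G`, so for any
measurable `T ≥ 0` with `T♭ = 1` the push-forward of `T μ_G` to `G ⧸ H` does not depend on `T`.
Translating `T` shows that it is `G`-invariant.

By Fatou's lemma the bound (Q) extends from the Gårding domain to `E`, so `v ↦ (g ↦ A π(g⁻¹) v)` is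
a bounded operator `W` which intertwines `π` with the induced representation. Under (F) the operator
`|W|` is invertible and commutes with `π`; replacing `A` by `A |W|⁻¹` makes the frame tight and `W`
isometric. Finally `‖|A| v‖ = ‖A v‖` and, as `ρ = 1` or `A = 0`, `|A|` commutes with `π|_H`: it
satisfies the hypotheses on `A` with `σ = π|_H`.
-/

namespace SqIntModSubgroup

section Garding

theorem exists_continuous_integral_eq_one_of_mem_nhds {X : Type*} [TopologicalSpace X] [R1Space X]
    [LocallyCompactSpace X] [MeasurableSpace X] [OpensMeasurableSpace X] (μ : Measure X)
    [IsFiniteMeasureOnCompacts μ] [μ.IsOpenPosMeasure] {x : X} {U : Set X} (hU : U ∈ nhds x) :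
    ∃ f : X → ℝ, Continuous f ∧ HasCompactSupport f ∧ 0 ≤ f ∧ support f ⊆ U ∧ ∫ y, f y ∂μ = 1 := by
  obtain ⟨V, hVU, hVo, hxV⟩ := mem_nhds_iff.1 hU
  obtain ⟨f, hfx, hfc, hfV, hf01⟩ := exists_continuousMap_one_of_isCompact_subset_isOpen
    (isCompact_singleton (x := x)) hVo (Set.singleton_subset_iff.2 hxV)
  have hf0 : 0 ≤ (f : X → ℝ) := fun y => (hf01 y).1
  have hpos : 0 < ∫ y, f y ∂μ :=
    f.continuous.integral_pos_of_hasCompactSupport_nonneg_nonzero hfc hf0 (x := x)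
      (by simp [hfx rfl])
  refine ⟨fun y => (∫ z, f z ∂μ)⁻¹ * f y, by fun_prop, HasCompactSupport.mul_left hfc,
    fun y => mul_nonneg (inv_nonneg.2 hpos.le) (hf0 y), fun y hy => ?_, ?_⟩
  · exact hVU (hfV (subset_tsupport f (right_ne_zero_of_mul hy)))
  · rw [integral_const_mul, inv_mul_cancel₀ hpos.ne']

variable {G E : Type*} [Group G] [TopologicalSpace G] [MeasurableSpace G] [OpensMeasurableSpace G]
  [NormedAddCommGroup E] [InnerProductSpace ℂ E]

theorem UnitaryRep.norm_smear_sub_le [CompleteSpace E] (π : UnitaryRep G E) {μ : Measure G}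
    [IsFiniteMeasureOnCompacts μ] {f : G → ℝ} (hf : Continuous f) (hfc : HasCompactSupport f)
    (hf0 : 0 ≤ f) (hf1 : ∫ g, f g ∂μ = 1) {v : E} {ε : ℝ}
    (hε : ∀ g ∈ support f, ‖π g v - v‖ ≤ ε) :
    ‖π.smear μ (fun g => (f g : ℂ)) v - v‖ ≤ ε := by
  have hfi : Integrable f μ := hf.integrable_of_hasCompactSupport hfc
  have hfvi : Integrable (fun g => (f g : ℂ) • v) μ := hfi.ofReal.smul_const v
  have hπi : Integrable (fun g => (f g : ℂ) • π g v) μ :=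
    ((Complex.continuous_ofReal.comp hf).smul
      (π.continuous_apply v)).integrable_of_hasCompactSupport
      (hfc.comp_left Complex.ofReal_zero).smul_right
  have hsub : π.smear μ (fun g => (f g : ℂ)) v - v = ∫ g, (f g : ℂ) • (π g v - v) ∂μ := by
    simp only [smul_sub]
    rw [integral_sub hπi hfvi, integral_smul_const, integral_complex_ofReal,
      hf1, Complex.ofReal_one, one_smul, UnitaryRep.smear]
  have hbound : ∀ g, ‖(f g : ℂ) • (π g v - v)‖ ≤ f g * ε := fun g => by
    rw [norm_smul, Complex.norm_real, Real.norm_of_nonneg (hf0 g)]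
    rcases eq_or_ne (f g) 0 with hg | hg
    · simp [hg]
    · exact mul_le_mul_of_nonneg_left (hε g hg) (hf0 g)
  calc ‖π.smear μ (fun g => (f g : ℂ)) v - v‖ ≤ ∫ g, f g * ε ∂μ :=
        hsub ▸ norm_integral_le_of_norm_le (hfi.mul_const ε) (.of_forall hbound)
    _ = ε := by rw [integral_mul_const, hf1, one_mul]

theorem UnitaryRep.dense_garding [IsTopologicalGroup G] [LocallyCompactSpace G] [CompleteSpace E]
    (π : UnitaryRep G E) (μ : Measure G) [IsFiniteMeasureOnCompacts μ] [μ.IsOpenPosMeasure] :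
    Dense (π.garding μ : Set E) := fun v => by
  refine Metric.mem_closure_iff.2 fun ε hε => ?_
  have hU : {g : G | ‖π g v - v‖ ≤ ε / 2} ∈ nhds (1 : G) := by
    have hc : Continuous fun g : G => ‖π g v - v‖ :=
      ((π.continuous_apply v).sub continuous_const).norm
    exact hc.continuousAt.eventually_le_const (by simpa using half_pos hε)
  obtain ⟨f, hf, hfc, hf0, hfU, hf1⟩ := exists_continuous_integral_eq_one_of_mem_nhds μ hU
  refine ⟨π.smear μ (fun g => (f g : ℂ)) v, Submodule.subset_span
    ⟨_, by fun_prop, hfc.comp_left Complex.ofReal_zero, v, rfl⟩, ?_⟩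
  rw [dist_comm, dist_eq_norm]
  exact (π.norm_smear_sub_le hf hfc hf0 hf1 hfU).trans_lt (half_lt_self hε)

end Garding

section CosetIntegral

variable {G : Type*} [Group G] [MeasurableSpace G] {H : Subgroup G}

/-- The integral `g ↦ ∫_H f(gh) dμ_H(h)` of `f` along the left cosets of `H`. It is kept as an
`H`-invariant function on `G` instead of a function on `G ⧸ H`. -/
noncomputable def cosetIntegral (μH : Measure H) (f : G → ℝ≥0∞) (g : G) : ℝ≥0∞ :=
  ∫⁻ h : H, f (g * h) ∂μH

theorem cosetIntegral_comp_mul_left (μH : Measure H) (f : G → ℝ≥0∞) (a g : G) :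
    cosetIntegral μH (fun x => f (a * x)) g = cosetIntegral μH f (a * g) := by
  simp only [cosetIntegral, mul_assoc]

theorem cosetIntegral_mul_right [MeasurableMul H] (μH : Measure H) [μH.IsMulLeftInvariant]
    (f : G → ℝ≥0∞) (g : G) (h : H) :
    cosetIntegral μH f (g * h) = cosetIntegral μH f g := by
  simpa only [cosetIntegral, Subgroup.coe_mul, mul_assoc] using
    lintegral_mul_left_eq_self (μ := μH) (fun x : H => f (g * x)) h

theorem cosetIntegral_mul_of_invariant [MeasurableMul G] (μH : Measure H) {f N : G → ℝ≥0∞}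
    (hf : Measurable f) (hN : ∀ (g : G) (h : H), N (g * h) = N g) (g : G) :
    cosetIntegral μH (fun x => f x * N x) g = cosetIntegral μH f g * N g := by
  simp only [cosetIntegral, hN]
  exact lintegral_mul_const _ (by fun_prop)

theorem cosetIntegral_indicator_const [MeasurableMul G] (μH : Measure H) {C : Set G}
    (hC : MeasurableSet C) (c : ℝ≥0∞) (g : G) :
    cosetIntegral μH (C.indicator fun _ => c) g = c * μH {h : H | g * h ∈ C} := by
  have hm : Measurable fun h : H => g * (h : G) := by fun_prop
  exact lintegral_indicator_const (hm hC) c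

theorem measure_le_cosetIntegral_indicator_mul [MeasurableMul G] [MeasurableMul H] (μH : Measure H)
    [μH.IsMulLeftInvariant] {C V : Set G} (hCV : MeasurableSet (C * V)) {c : G} (hc : c ∈ C)
    (h : H) :
    μH (Subtype.val ⁻¹' V) ≤ cosetIntegral μH ((C * V).indicator fun _ => 1) (c * h) := by
  rw [cosetIntegral_mul_right, cosetIntegral_indicator_const μH hCV, one_mul]
  exact measure_mono fun k hk => Set.mul_mem_mul hc hk

theorem measurable_cosetIntegral [MeasurableMul₂ G] (μH : Measure H) [SFinite μH] {f : G → ℝ≥0∞}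
    (hf : Measurable f) : Measurable (cosetIntegral μH f) :=
  Measurable.lintegral_prod_right' (f := fun z : G × H => f (z.1 * z.2)) (by fun_prop)

theorem measure_setOf_mul_mem_le [MeasurableMul H] (μH : Measure H) [μH.IsMulLeftInvariant]
    (C : Set G) (g : G) :
    μH {h : H | g * h ∈ C} ≤ μH (Subtype.val ⁻¹' (C⁻¹ * C)) := by
  rcases Set.eq_empty_or_nonempty {h : H | g * h ∈ C} with hempty | ⟨h₀, hh₀⟩
  · simp [hempty]
  · rw [← measure_preimage_mul μH h₀]
    refine measure_mono fun h hh => ?_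
    exact Set.mem_mul.2
      ⟨(g * h₀)⁻¹, Set.inv_mem_inv.2 hh₀, g * (h₀ * h : H), hh, by simp [mul_assoc]⟩

variable [TopologicalSpace G]

theorem measure_val_preimage_ne_top (hH : IsClosed (H : Set G)) (μH : Measure H)
    [IsFiniteMeasureOnCompacts μH] {C : Set G} (hC : IsCompact C) :
    μH (Subtype.val ⁻¹' C) ≠ ∞ :=
  (hH.isClosedEmbedding_subtypeVal.isCompact_preimage hC).measure_ne_top

variable [IsTopologicalGroup G] [BorelSpace G]

theorem exists_cosetIntegral_ne_top [T2Space G] [SigmaCompactSpace G] (hH : IsClosed (H : Set G))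
    (μH : Measure H) [μH.IsMulLeftInvariant] [IsFiniteMeasureOnCompacts μH] :
    ∃ φ : G → ℝ≥0∞, Measurable φ ∧ (∀ g, φ g ≠ 0) ∧ ∀ g, cosetIntegral μH φ g ≠ ∞ := by
  let Q : ℕ → Set G := compactCovering G
  have hQ : ∀ n, IsCompact (Q n) := isCompact_compactCovering G
  have hQm : ∀ n, MeasurableSet (Q n) := fun n => (hQ n).measurableSet
  obtain ⟨δ, hδ0, hδ⟩ := ENNReal.exists_pos_tsum_mul_lt_of_countable one_ne_zero
    (fun n => μH (Subtype.val ⁻¹' ((Q n)⁻¹ * Q n)))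
    (fun n => measure_val_preimage_ne_top hH μH ((hQ n).inv.mul (hQ n)))
  let φ : G → ℝ≥0∞ := fun x => ∑' n, (Q n).indicator (fun _ => (δ n : ℝ≥0∞)) x
  refine ⟨φ, .tsum fun n => measurable_const.indicator (hQm n), fun x hx => ?_, fun g => ?_⟩
  · obtain ⟨n, hn⟩ := Set.mem_iUnion.1 ((iUnion_compactCovering G).symm ▸ Set.mem_univ x)
    have hδn := ENNReal.tsum_eq_zero.1 hx n
    rw [Set.indicator_of_mem hn] at hδn
    exact (hδ0 n).ne' (by simpa using hδn)
  · refine ne_top_of_le_ne_top ENNReal.one_ne_top (le_trans ?_ hδ.le)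
    calc cosetIntegral μH φ g
        = ∑' n, cosetIntegral μH ((Q n).indicator fun _ => (δ n : ℝ≥0∞)) g :=
          lintegral_tsum fun n => ((measurable_const.indicator (hQm n)).comp
            (by fun_prop : Measurable fun h : H => g * (h : G))).aemeasurable
      _ ≤ ∑' n, μH (Subtype.val ⁻¹' ((Q n)⁻¹ * Q n)) * δ n := ENNReal.tsum_le_tsum fun n => by
          rw [cosetIntegral_indicator_const μH (hQm n), mul_comm]
          exact mul_le_mul_left (measure_setOf_mul_mem_le μH (Q n) g) _

theorem exists_cosetIntegral_eq_one [SecondCountableTopology G] [T2Space G] [SigmaCompactSpace G]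
    (hH : IsClosed (H : Set G)) (μH : Measure H) [μH.IsMulLeftInvariant]
    [IsFiniteMeasureOnCompacts μH] [SFinite μH] [NeZero μH] :
    ∃ T : G → ℝ≥0∞, Measurable T ∧ ∀ g, cosetIntegral μH T g = 1 := by
  obtain ⟨φ, hφ, hφ0, hφ1⟩ := exists_cosetIntegral_ne_top hH μH
  have hpos : ∀ g, cosetIntegral μH φ g ≠ 0 := fun g hg => by
    rw [cosetIntegral, lintegral_eq_zero_iff (by fun_prop)] at hg
    obtain ⟨h, hh⟩ := hg.exists
    exact hφ0 _ hh
  have hI := measurable_cosetIntegral μH hφ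
  refine ⟨fun g => φ g * (cosetIntegral μH φ g)⁻¹, hφ.mul hI.inv, fun g => ?_⟩
  rw [cosetIntegral_mul_of_invariant μH hφ fun g h => by rw [cosetIntegral_mul_right]]
  exact ENNReal.mul_inv_cancel (hpos g) (hφ1 g)

end CosetIntegral

section QuotientMeasure

variable {G : Type*} [Group G] [MeasurableSpace G] {H : Subgroup G}

/-- The push-forward of `T μ_G` to `G ⧸ H`. If `T` integrates to one along each left coset of `H`,
this is the measure of Weil's formula `∫_G f = ∫_{G/H} ∫_H f(gh) dμ_H(h)`; building it from `T`
avoids the Riesz representation theorem. -/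
noncomputable def quotientMeasure (H : Subgroup G) (μG : Measure G) (T : G → ℝ≥0∞) :
    Measure (G ⧸ H) :=
  map QuotientGroup.mk (μG.withDensity T)

theorem lintegral_quotientMeasure {μG : Measure G} {T : G → ℝ≥0∞} (hT : Measurable T)
    {N : G ⧸ H → ℝ≥0∞} (hN : Measurable N) :
    ∫⁻ x, N x ∂quotientMeasure H μG T = ∫⁻ g : G, T g * N g ∂μG := by
  have hmk : Measurable (QuotientGroup.mk : G → G ⧸ H) := measurable_from_quotient.1 measurable_id
  rw [quotientMeasure, lintegral_map hN hmk]
  exact lintegral_withDensity_eq_lintegral_mul μG hT (hN.comp hmk)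

end QuotientMeasure

section InvariantMeasure

variable {G : Type*} [Group G] [TopologicalSpace G] [IsTopologicalGroup G] [LocallyCompactSpace G]
  {H : Subgroup G} [LocallyCompactSpace H]

theorem modRatio_eq_one_iff (h : H) : modRatio H h = 1 ↔ modFun (h : G) = modFun h := by
  have hne : modFun (h : G) ≠ 0 := inv_ne_zero (modularCharacterFun_pos (h : G)).ne'
  rw [modRatio, div_eq_one_iff_eq hne, eq_comm]

variable [SecondCountableTopology G] [T2Space G] [MeasurableSpace G] [BorelSpace G]
  {μG : Measure G} [μG.IsHaarMeasure] {μH : Measure H} [μH.IsHaarMeasure]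

theorem lintegral_mul_cosetIntegral_comm (hΔ : ∀ h : H, modFun (h : G) = modFun h)
    {f k : G → ℝ≥0∞} (hf : Measurable f) (hk : Measurable k) :
    ∫⁻ g, f g * cosetIntegral μH k g ∂μG = ∫⁻ g, k g * cosetIntegral μH f g ∂μG := by
  have : SecondCountableTopology H := TopologicalSpace.Subtype.secondCountableTopology (H : Set G)
  have hΔm := measurable_modularCharacter (G := H)
  calc ∫⁻ g, f g * cosetIntegral μH k g ∂μG
      = ∫⁻ g, ∫⁻ h : H, f g * k (g * h) ∂μH ∂μG :=
        lintegral_congr fun g => (lintegral_const_mul _ (by fun_prop)).symm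
    _ = ∫⁻ h : H, ∫⁻ g, f g * k (g * h) ∂μG ∂μH :=
        lintegral_lintegral_swap (Measurable.aemeasurable (by unfold Function.uncurry; fun_prop))
    _ = ∫⁻ h : H, ∫⁻ g, k g * ((modularCharacter h : ℝ≥0∞) * f (g * (h⁻¹ : H))) ∂μG ∂μH :=
        lintegral_congr fun h => by
          simpa only [mul_one] using lintegral_covariant_swap (N := fun _ => 1) hf hk h
            (.of_forall fun _ => by rw [(modRatio_eq_one_iff h⁻¹).2 (hΔ h⁻¹)]; simp)
    _ = ∫⁻ g, ∫⁻ h : H, k g * ((modularCharacter h : ℝ≥0∞) * f (g * (h⁻¹ : H))) ∂μH ∂μG :=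
        (lintegral_lintegral_swap ((hk.comp measurable_fst).mul
          ((hΔm.comp measurable_snd).mul (by fun_prop))).aemeasurable).symm
    _ = ∫⁻ g, k g * cosetIntegral μH f g ∂μG := lintegral_congr fun g => by
        rw [lintegral_const_mul _ (by exact hΔm.mul (by fun_prop)), cosetIntegral,
          lintegral_modular_inv μH (f := fun h : H => f (g * h)) (by fun_prop)]

theorem lintegral_mul_cosetIntegral (hΔ : ∀ h : H, modFun (h : G) = modFun h)
    {T f : G → ℝ≥0∞} (hT : Measurable T) (hT1 : ∀ g, cosetIntegral μH T g = 1)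
    (hf : Measurable f) :
    ∫⁻ g, T g * cosetIntegral μH f g ∂μG = ∫⁻ g, f g ∂μG := by
  rw [lintegral_mul_cosetIntegral_comm hΔ hT hf]
  simp only [hT1, mul_one]

theorem quotientMeasure_ne_zero (hΔ : ∀ h : H, modFun (h : G) = modFun h) {T : G → ℝ≥0∞}
    (hT : Measurable T) (hT1 : ∀ g, cosetIntegral μH T g = 1) :
    quotientMeasure H μG T ≠ 0 := fun h0 => by
  have hT0 : T =ᵐ[μG] 0 := by
    have h := lintegral_quotientMeasure (H := H) (μG := μG) hT (measurable_const (a := 1))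
    simp only [h0, lintegral_zero_measure, mul_one] at h
    exact (lintegral_eq_zero_iff hT).1 h.symm
  have hμ : μG Set.univ = 0 := by
    rw [← lintegral_one, ← lintegral_mul_cosetIntegral hΔ hT hT1 measurable_const]
    exact (lintegral_congr_ae (hT0.mono fun g hg => by simp [hg])).trans lintegral_zero
  exact NeZero.ne μG (measure_univ_eq_zero.1 hμ)

theorem measure_mul_quotientMeasure_image_le (hΔ : ∀ h : H, modFun (h : G) = modFun h)
    {T : G → ℝ≥0∞} (hT : Measurable T) (hT1 : ∀ g, cosetIntegral μH T g = 1) {U : Set G}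
    (hU : IsOpen U) (V : Set G) :
    μH (Subtype.val ⁻¹' V) * quotientMeasure H μG T (QuotientGroup.mk '' U) ≤ μG (U * V) := by
  have hUV : MeasurableSet (U * V) := hU.mul_right.measurableSet
  let S : Set (G ⧸ H) := QuotientGroup.mk '' U
  have hS : MeasurableSet S := measurableSet_quotient.2
    ((QuotientGroup.isOpenMap_coe U hU).preimage QuotientGroup.continuous_mk).measurableSet
  have hle (g : G) : μH (Subtype.val ⁻¹' V) * S.indicator 1 (g : G ⧸ H) ≤
      cosetIntegral μH ((U * V).indicator fun _ => 1) g := by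
    by_cases hg : (g : G ⧸ H) ∈ S
    · have ⟨u, hu, hug⟩ := hg
      obtain ⟨h, rfl⟩ : ∃ h : H, u * h = g :=
        ⟨⟨u⁻¹ * g, QuotientGroup.eq.1 hug⟩, mul_inv_cancel_left u g⟩
      rw [Set.indicator_of_mem hg, Pi.one_apply, mul_one]
      exact measure_le_cosetIntegral_indicator_mul μH hUV hu h
    · simp [hg]
  calc μH (Subtype.val ⁻¹' V) * quotientMeasure H μG T S
      = ∫⁻ g : G, T g * (μH (Subtype.val ⁻¹' V) * S.indicator 1 (g : G ⧸ H)) ∂μG := by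
        rw [← lintegral_indicator_one hS, ← lintegral_const_mul _ (measurable_one.indicator hS)]
        exact lintegral_quotientMeasure hT ((measurable_one.indicator hS).const_mul _)
    _ ≤ ∫⁻ g, T g * cosetIntegral μH ((U * V).indicator fun _ => 1) g ∂μG :=
        lintegral_mono fun g => mul_le_mul_right (hle g) _
    _ = ∫⁻ g, (U * V).indicator (fun _ => 1) g ∂μG :=
        lintegral_mul_cosetIntegral hΔ hT hT1 (measurable_const.indicator hUV)
    _ = μG (U * V) := by rw [lintegral_indicator_const hUV, one_mul]

theorem isLocallyFiniteMeasure_quotientMeasure (hΔ : ∀ h : H, modFun (h : G) = modFun h)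
    {T : G → ℝ≥0∞} (hT : Measurable T) (hT1 : ∀ g, cosetIntegral μH T g = 1) :
    IsLocallyFiniteMeasure (quotientMeasure H μG T) := by
  refine ⟨fun x => ?_⟩
  obtain ⟨g, rfl⟩ := QuotientGroup.mk_surjective x
  obtain ⟨C, hC, hCg⟩ := exists_compact_mem_nhds g
  obtain ⟨V, hV, hV1⟩ := exists_compact_mem_nhds (1 : G)
  refine ⟨QuotientGroup.mk '' interior C, (QuotientGroup.isOpenMap_coe _ isOpen_interior).mem_nhds
    (Set.mem_image_of_mem _ (mem_interior_iff_mem_nhds.2 hCg)), ?_⟩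
  have hpos : μH (Subtype.val ⁻¹' V) ≠ 0 :=
    (measure_pos_of_mem_nhds μH (continuous_subtype_val.continuousAt.preimage_mem_nhds
      (x := (1 : H)) (by simpa using hV1))).ne'
  have hfin : μH (Subtype.val ⁻¹' V) * quotientMeasure H μG T (QuotientGroup.mk '' interior C) <
      ∞ :=
    calc _ ≤ μG (interior C * V) :=
          measure_mul_quotientMeasure_image_le hΔ hT hT1 isOpen_interior V
      _ ≤ μG (C * V) := measure_mono (Set.mul_subset_mul_right interior_subset)
      _ < ∞ := (hC.mul hV).measure_lt_top
  exact ENNReal.lt_top_of_mul_ne_top_right hfin.ne hpos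

theorem smulInvariantMeasure_quotientMeasure (hΔ : ∀ h : H, modFun (h : G) = modFun h)
    {T : G → ℝ≥0∞} (hT : Measurable T) (hT1 : ∀ g, cosetIntegral μH T g = 1) :
    SMulInvariantMeasure G (G ⧸ H) (quotientMeasure H μG T) := by
  refine ⟨fun a s hs => ?_⟩
  have hmk : Measurable (QuotientGroup.mk : G → G ⧸ H) := measurable_from_quotient.1 measurable_id
  have has : MeasurableSet ((a • · : G ⧸ H → G ⧸ H) ⁻¹' s) :=
    measurableSet_quotient.2 (measurable_const_mul a (hmk hs))
  let N : G ⧸ H → ℝ≥0∞ := s.indicator 1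
  have hN : Measurable N := measurable_one.indicator hs
  have hNG : Measurable fun g : G => N g := hN.comp hmk
  have hcoset : ∀ g, cosetIntegral μH (fun x => T (a⁻¹ * x) * N x) g = N g := fun g => by
    rw [cosetIntegral_mul_of_invariant μH (by fun_prop)
      fun g h => by rw [QuotientGroup.mk_mul_of_mem g h.2],
      cosetIntegral_comp_mul_left, hT1, one_mul]
  rw [← lintegral_indicator_one has, ← lintegral_indicator_one hs,
    lintegral_quotientMeasure hT (measurable_one.indicator has), lintegral_quotientMeasure hT hN]
  calc ∫⁻ g : G, T g * ((a • ·) ⁻¹' s).indicator 1 (g : G ⧸ H) ∂μG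
      = ∫⁻ g, T (a⁻¹ * g) * N g ∂μG := by
        rw [← lintegral_mul_left_eq_self (fun g => T (a⁻¹ * g) * N g) a]
        simp only [inv_mul_cancel_left]
        rfl
    _ = ∫⁻ g, T g * cosetIntegral μH (fun x => T (a⁻¹ * x) * N x) g ∂μG :=
        (lintegral_mul_cosetIntegral hΔ hT hT1 (by fun_prop)).symm
    _ = ∫⁻ g : G, T g * N g ∂μG := by simp only [hcoset]

theorem exists_invariant_measure_quotient (hH : IsClosed (H : Set G))
    (hΔ : ∀ h : H, modFun (h : G) = modFun h) :
    ∃ ν : Measure (G ⧸ H), ν ≠ 0 ∧ IsFiniteMeasureOnCompacts ν ∧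
      SMulInvariantMeasure G (G ⧸ H) ν := by
  have : SecondCountableTopology H := TopologicalSpace.Subtype.secondCountableTopology (H : Set G)
  obtain ⟨T, hT, hT1⟩ := exists_cosetIntegral_eq_one hH (haar : Measure H)
  have := isLocallyFiniteMeasure_quotientMeasure (μG := haar) hΔ hT hT1
  exact ⟨quotientMeasure H haar T, quotientMeasure_ne_zero hΔ hT hT1, inferInstance,
    smulInvariantMeasure_quotientMeasure hΔ hT hT1⟩

end InvariantMeasure

section AbsoluteValue

variable {E F : Type*} [NormedAddCommGroup E] [InnerProductSpace ℂ E]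
  [NormedAddCommGroup F] [InnerProductSpace ℂ F]

theorem inner_apply_apply_of_norm_eq {X : E →L[ℂ] F} {U : E ≃ₗᵢ[ℂ] E}
    (hU : ∀ v, ‖X (U v)‖ = ‖X v‖) (u v : E) :
    inner ℂ (X (U u)) (X (U v)) = inner ℂ (X u) (X v) := by
  simp only [inner_eq_sum_norm_sq_div_four, ← map_add, ← map_sub, ← map_smul, hU]

variable [CompleteSpace E]

/-- The operator `X† X`. It is defined through the form `(u, v) ↦ ⟪X u, X v⟫`, so that `F` need not
be complete. -/
noncomputable def gram (X : E →L[ℂ] F) : E →L[ℂ] E :=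
  InnerProductSpace.continuousLinearMapOfBilin ((innerSL ℂ).bilinearComp X X)

/-- The absolute value `|X| = √(X† X)` of a bounded operator. -/
noncomputable def absValue (X : E →L[ℂ] F) : E →L[ℂ] E := CFC.sqrt (gram X)

theorem inner_gram_left (X : E →L[ℂ] F) (u v : E) :
    inner ℂ (gram X u) v = inner ℂ (X u) (X v) :=
  InnerProductSpace.continuousLinearMapOfBilin_apply _ u v

theorem gram_nonneg (X : E →L[ℂ] F) : 0 ≤ gram X := by
  refine (ContinuousLinearMap.nonneg_iff_isPositive _).2
    (ContinuousLinearMap.isPositive_def.2 ⟨fun u v => ?_, fun v => ?_⟩)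
  · change inner ℂ (gram X u) v = inner ℂ u (gram X v)
    rw [inner_gram_left, ← inner_conj_symm u, inner_gram_left, inner_conj_symm]
  · rw [ContinuousLinearMap.reApplyInnerSelf_apply, inner_gram_left]
    exact inner_self_nonneg

theorem absValue_mul_self (X : E →L[ℂ] F) : absValue X * absValue X = gram X :=
  CFC.sqrt_mul_sqrt_self _ (gram_nonneg X)

theorem norm_absValue_apply (X : E →L[ℂ] F) (v : E) : ‖absValue X v‖ = ‖X v‖ := by
  have hsymm : (absValue X).adjoint = absValue X :=
    (CFC.sqrt_nonneg (gram X)).isSelfAdjoint.adjoint_eq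
  have hinner : inner ℂ (absValue X v) (absValue X v) = inner ℂ (X v) (X v) := by
    rw [← (absValue X).adjoint_inner_left, hsymm, ← mul_apply_eq_comp, absValue_mul_self,
      inner_gram_left]
  rw [norm_eq_sqrt_re_inner (𝕜 := ℂ), norm_eq_sqrt_re_inner (𝕜 := ℂ) (X v), hinner]

theorem gram_commute {X : E →L[ℂ] F} {U : E ≃ₗᵢ[ℂ] E} (hU : ∀ v, ‖X (U v)‖ = ‖X v‖) :
    Commute (gram X) (U.toContinuousLinearEquiv : E →L[ℂ] E) := by
  ext u
  refine ext_inner_right ℂ fun w => ?_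
  obtain ⟨w, rfl⟩ := U.surjective w
  change inner ℂ (gram X (U u)) (U w) = inner ℂ (U (gram X u)) (U w)
  rw [inner_gram_left, inner_apply_apply_of_norm_eq hU, U.inner_map_map, inner_gram_left]

theorem absValue_apply_comm {X : E →L[ℂ] F} {U : E ≃ₗᵢ[ℂ] E} (hU : ∀ v, ‖X (U v)‖ = ‖X v‖)
    (v : E) : absValue X (U v) = U (absValue X v) :=
  DFunLike.congr_fun ((gram_commute hU).cfcₙ_nnreal NNReal.sqrt) v

theorem isUnit_absValue {X : E →L[ℂ] F} {α : ℝ} (hα : 0 < α)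
    (hX : ∀ v, α * ‖v‖ ^ 2 ≤ ‖X v‖ ^ 2) : IsUnit (absValue X) := by
  refine (CFC.isUnit_sqrt_iff _ (gram_nonneg X)).2
    (ContinuousLinearMap.isUnit_of_forall_le_norm_inner_map _ (c := ⟨α, hα.le⟩) hα fun v => ?_)
  rw [inner_gram_left, inner_self_eq_norm_sq_to_K, norm_pow, RCLike.norm_ofReal, abs_norm, mul_comm]
  exact hX v

theorem exists_norm_comp_eq_of_bounded_below {X : E →L[ℂ] F} {α : ℝ} (hα : 0 < α)
    (hX : ∀ v, α * ‖v‖ ^ 2 ≤ ‖X v‖ ^ 2) : ∃ T : E →L[ℂ] E, (∀ v, ‖X (T v)‖ = ‖v‖) ∧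
    ∀ U : E ≃ₗᵢ[ℂ] E, (∀ v, ‖X (U v)‖ = ‖X v‖) → ∀ v, T (U v) = U (T v) := by
  obtain ⟨T, hT, hT'⟩ := isUnit_iff_exists.1 (isUnit_absValue hα hX)
  have hright : ∀ v, absValue X (T v) = v := DFunLike.congr_fun hT
  have hleft : ∀ v, T (absValue X v) = v := DFunLike.congr_fun hT'
  refine ⟨T, fun v => by rw [← norm_absValue_apply, hright], fun U hU v => ?_⟩
  rw [← hleft (U (T v)), absValue_apply_comm hU, hright]

end AbsoluteValue

section SemiInvariantOperator

variable {G : Type*} [Group G] [TopologicalSpace G]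
  {E : Type*} [NormedAddCommGroup E] [InnerProductSpace ℂ E]

theorem UnitaryRep.mul_apply (π : UnitaryRep G E) (a b : G) (v : E) :
    π (a * b) v = π a (π b v) :=
  DFunLike.congr_fun (π.toHom.map_mul a b) v

theorem UnitaryRep.one_apply (π : UnitaryRep G E) (v : E) : π 1 v = v :=
  DFunLike.congr_fun π.toHom.map_one v

variable [IsTopologicalGroup G] {K : Type*} [NormedAddCommGroup K] [InnerProductSpace ℂ K]

theorem continuous_orbit (π : UnitaryRep G E) (A : E →L[ℂ] K) (v : E) :
    Continuous fun g : G => A (π g⁻¹ v) :=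
  A.continuous.comp ((π.continuous_apply v).comp continuous_inv)

variable [LocallyCompactSpace G] {H : Subgroup G} [LocallyCompactSpace H]
  {π : UnitaryRep G E} {σ : UnitaryRep H K} {A : E →L[ℂ] K}

/-- Condition (S) for a bounded operator, required on the whole space of `π` and not only on the
Gårding domain. -/
def IsSemiInvariantOperator (π : UnitaryRep G E) (σ : UnitaryRep H K) (A : E →L[ℂ] K) : Prop :=
  ∀ (h : H) (v : E), σ h (A v) = ((√(modRatio H h : ℝ) : ℝ) : ℂ) • A (π (h : G) v)

theorem isSemiInvariant_domRestrict_iff [MeasurableSpace G] [BorelSpace G] [CompleteSpace E]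
    {μ : Measure G} [μ.IsHaarMeasure] :
    IsSemiInvariant σ (A.toLinearMap.domRestrict (π.garding μ)) ↔
      IsSemiInvariantOperator π σ A := by
  refine ⟨fun hA h => ?_, fun hA h v => hA h v⟩
  refine congr_fun (Continuous.ext_on (π.dense_garding μ) ?_ ?_ fun v hv => hA h ⟨v, hv⟩)
  · exact (σ h).continuous.comp A.continuous
  · exact (A.continuous.comp (π (h : G)).continuous).const_smul _

namespace IsSemiInvariantOperator

theorem apply_inv (hA : IsSemiInvariantOperator π σ A) (h : H) (v : E) :
    A (π (h : G)⁻¹ v) = ((√(modRatio H h : ℝ) : ℝ) : ℂ) • σ h⁻¹ (A v) := by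
  have hσ := congrArg (σ h⁻¹) (hA h (π (h : G)⁻¹ v))
  rwa [← σ.mul_apply, inv_mul_cancel, σ.one_apply, ← π.mul_apply, mul_inv_cancel, π.one_apply,
    map_smul] at hσ

theorem opNorm_eq (hA : IsSemiInvariantOperator π σ A) (h : H) :
    ‖A‖ = √(modRatio H h : ℝ) * ‖A‖ := by
  have hcomp : (σ h).toLinearIsometry.toContinuousLinearMap ∘L A =
      ((√(modRatio H h : ℝ) : ℝ) : ℂ) • (A ∘L (π (h : G)).toContinuousLinearEquiv) :=
    ContinuousLinearMap.ext (hA h)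
  have hnorm := congrArg norm hcomp
  rwa [LinearIsometry.norm_toContinuousLinearMap_comp, norm_smul, Complex.norm_real,
    Real.norm_of_nonneg (Real.sqrt_nonneg _),
    ContinuousLinearMap.opNorm_comp_linearIsometryEquiv] at hnorm

theorem modRatio_eq_one (hA : IsSemiInvariantOperator π σ A) (hA0 : A ≠ 0) (h : H) :
    modRatio H h = 1 := by
  have hsqrt : √(modRatio H h : ℝ) = 1 :=
    (mul_eq_right₀ (norm_ne_zero_iff.2 hA0)).1 (hA.opNorm_eq h).symm
  exact_mod_cast Real.sqrt_eq_one.1 hsqrt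

theorem comp {T : E →L[ℂ] E} (hA : IsSemiInvariantOperator π σ A)
    (hT : ∀ g v, T (π g v) = π g (T v)) : IsSemiInvariantOperator π σ (A ∘L T) := fun h v => by
  simp only [ContinuousLinearMap.comp_apply, hA h, hT]

theorem absValue [CompleteSpace E] (hA : IsSemiInvariantOperator π σ A) :
    IsSemiInvariantOperator π (π.restrict H) (absValue A) := fun h v => by
  rcases eq_or_ne A 0 with rfl | hA0
  · have hzero (w : E) : SqIntModSubgroup.absValue (0 : E →L[ℂ] K) w = 0 :=
      norm_eq_zero.1 (by simp [norm_absValue_apply])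
    rw [hzero, hzero, map_zero, smul_zero]
  · have hρ (w : E) : ((√(modRatio H h : ℝ) : ℝ) : ℂ) • w = w := by
      simp [hA.modRatio_eq_one hA0 h]
    have hnorm (w : E) : ‖A (π (h : G) w)‖ = ‖A w‖ := by
      have := hA h w
      simp only [hA.modRatio_eq_one hA0 h, NNReal.coe_one, Real.sqrt_one, Complex.ofReal_one,
        one_smul] at this
      rw [← this, LinearIsometryEquiv.norm_map]
    rw [hρ]
    exact (absValue_apply_comm hnorm v).symm

end IsSemiInvariantOperator

end SemiInvariantOperator

section Energy

variable {G : Type*} [Group G] [TopologicalSpace G] [IsTopologicalGroup G]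
  [MeasurableSpace G] [BorelSpace G] {μG : Measure G} [μG.IsHaarMeasure] {θ : G → ℝ}
  {E : Type*} [NormedAddCommGroup E] [InnerProductSpace ℂ E] [CompleteSpace E]
  {K : Type*} [NormedAddCommGroup K] [InnerProductSpace ℂ K] {π : UnitaryRep G E}

theorem energy_domRestrict (θ : G → ℝ) (A : E →L[ℂ] K) (v : π.garding μG) :
    energy θ (A.toLinearMap.domRestrict (π.garding μG)) v =
      ∫⁻ g, ‖A (π g⁻¹ (v : E))‖ₑ ^ 2 ∂(thetaMeasure μG θ) :=
  rfl

theorem energy_domRestrict_absValue (θ : G → ℝ) (A : E →L[ℂ] K) (v : π.garding μG) :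
    energy θ ((absValue A).toLinearMap.domRestrict (π.garding μG)) v =
      energy θ (A.toLinearMap.domRestrict (π.garding μG)) v := by
  simp only [energy_domRestrict, ← ofReal_norm, norm_absValue_apply]

theorem IsFrame.domRestrict_absValue {A : E →L[ℂ] K}
    (hF : IsFrame θ (A.toLinearMap.domRestrict (π.garding μG))) :
    IsFrame θ ((absValue A).toLinearMap.domRestrict (π.garding μG)) := by
  simpa only [IsFrame, energy_domRestrict_absValue] using hF

theorem IsFrame.isSquareBounded {B : π.garding μG →ₗ[ℂ] K} (hB : IsFrame θ B) :
    IsSquareBounded θ B := by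
  obtain ⟨α, β, hα, hαβ, h⟩ := hB
  exact ⟨β, hα.trans_le hαβ, fun v => (h v).2⟩

theorem IsTightFrame.isFrame {B : π.garding μG →ₗ[ℂ] K} (hB : IsTightFrame θ B) : IsFrame θ B :=
  ⟨1, 1, one_pos, le_rfl, fun v => by simp [hB v]⟩

end Energy

section InducedNorm

variable {G : Type*} [Group G] [TopologicalSpace G] [IsTopologicalGroup G] [LocallyCompactSpace G]
  [MeasurableSpace G] {H : Subgroup G} [LocallyCompactSpace H] {μG : Measure G} {θ : G → ℝ}
  {K : Type*} [NormedAddCommGroup K] [InnerProductSpace ℂ K] {σ : UnitaryRep H K} {F F' : G → K}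

theorem IsInduced.toInd_congr (hF : IsInduced μG θ σ F)
    (hF' : IsInduced μG θ σ F') (h : F = F') : hF.toInd = hF'.toInd := by
  subst h; rfl

theorem IsInduced.ofReal_norm_toInd_sq (hF : IsInduced μG θ σ F) :
    ENNReal.ofReal (‖hF.toInd‖ ^ 2) = ∫⁻ g, ‖F g‖ₑ ^ 2 ∂(thetaMeasure μG θ) := by
  rw [hF.norm_toInd, ← ENNReal.toReal_pow, ← ENNReal.rpow_natCast, ← ENNReal.rpow_mul,
    Nat.cast_ofNat, one_div, inv_mul_cancel₀ two_ne_zero, ENNReal.rpow_one,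
    ENNReal.ofReal_toReal hF.lintegral_lt_top.ne]

end InducedNorm

section Wavelet

variable {G : Type*} [Group G] [TopologicalSpace G] [IsTopologicalGroup G] [LocallyCompactSpace G]
  [MeasurableSpace G] [BorelSpace G] {H : Subgroup G} [LocallyCompactSpace H]
  {μG : Measure G} [μG.IsHaarMeasure] {μH : Measure H} {θ : G → ℝ}
  {E : Type*} [NormedAddCommGroup E] [InnerProductSpace ℂ E] [CompleteSpace E]
  {K : Type*} [NormedAddCommGroup K] [InnerProductSpace ℂ K]
  {π : UnitaryRep G E} {σ : UnitaryRep H K} {A : E →L[ℂ] K}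

theorem IsWaveletTransform.unique {B : π.garding μG →ₗ[ℂ] K} {W W' : E →L[ℂ] Ind μG θ σ}
    (hW : IsWaveletTransform B W) (hW' : IsWaveletTransform B W') : W = W' := by
  refine DFunLike.coe_injective
    (Continuous.ext_on (π.dense_garding μG) W.continuous W'.continuous fun v hv => ?_)
  obtain ⟨_, h⟩ := hW ⟨v, hv⟩
  obtain ⟨_, h'⟩ := hW' ⟨v, hv⟩
  exact h.trans h'.symm

theorem lintegral_orbit_le {β : ℝ} (hβ : ∀ v : π.garding μG,
    energy θ (A.toLinearMap.domRestrict (π.garding μG)) v ≤ ENNReal.ofReal (β * ‖v‖ ^ 2)) (v : E) :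
    ∫⁻ g, ‖A (π g⁻¹ v)‖ₑ ^ 2 ∂(thetaMeasure μG θ) ≤ ENNReal.ofReal (β * ‖v‖ ^ 2) := by
  obtain ⟨x, hx, hxv⟩ := mem_closure_iff_seq_limit.1 (π.dense_garding μG v)
  have hpointwise (g : G) : ‖A (π g⁻¹ v)‖ₑ ^ 2 =
      Filter.liminf (fun n => ‖A (π g⁻¹ (x n))‖ₑ ^ 2) Filter.atTop := by
    have hc : Continuous fun u : E => ‖A (π g⁻¹ u)‖ₑ ^ 2 :=
      (ENNReal.continuous_pow 2).comp (A.continuous.comp (π g⁻¹).continuous).enorm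
    exact ((hc.tendsto v).comp hxv).liminf_eq.symm
  have hbound : Filter.Tendsto (fun n => ENNReal.ofReal (β * ‖x n‖ ^ 2)) Filter.atTop
      (nhds (ENNReal.ofReal (β * ‖v‖ ^ 2))) :=
    ENNReal.tendsto_ofReal ((hxv.norm.pow 2).const_mul β)
  calc ∫⁻ g, ‖A (π g⁻¹ v)‖ₑ ^ 2 ∂(thetaMeasure μG θ)
      = ∫⁻ g, Filter.liminf (fun n => ‖A (π g⁻¹ (x n))‖ₑ ^ 2) Filter.atTop
          ∂(thetaMeasure μG θ) := lintegral_congr hpointwise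
    _ ≤ Filter.liminf (fun n => ∫⁻ g, ‖A (π g⁻¹ (x n))‖ₑ ^ 2 ∂(thetaMeasure μG θ)) Filter.atTop :=
        lintegral_liminf_le fun n =>
          ((ENNReal.continuous_pow 2).comp (continuous_orbit π A (x n)).enorm).measurable
    _ ≤ Filter.liminf (fun n => ENNReal.ofReal (β * ‖x n‖ ^ 2)) Filter.atTop :=
        Filter.liminf_le_liminf (.of_forall fun n => hβ ⟨x n, hx n⟩)
    _ = ENNReal.ofReal (β * ‖v‖ ^ 2) := hbound.liminf_eq

variable [SecondCountableTopology G]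

namespace IsSemiInvariantOperator

theorem isInduced_orbit (hA : IsSemiInvariantOperator π σ A)
    (hQ : IsSquareBounded θ (A.toLinearMap.domRestrict (π.garding μG))) (v : E) :
    IsInduced μG θ σ fun g => A (π g⁻¹ v) where
  aestronglyMeasurable := (continuous_orbit π A v).aestronglyMeasurable
  covariant h := .of_forall fun g => by
    rw [mul_inv_rev, π.mul_apply]
    exact hA.apply_inv h (π g⁻¹ v)
  lintegral_lt_top := by
    obtain ⟨β, -, hβ⟩ := hQ
    exact (lintegral_orbit_le hβ v).trans_lt ENNReal.ofReal_lt_top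

theorem isAdmissible_domRestrict (hA : IsSemiInvariantOperator π σ A)
    (hQ : IsSquareBounded θ (A.toLinearMap.domRestrict (π.garding μG))) :
    IsAdmissible θ σ (A.toLinearMap.domRestrict (π.garding μG)) where
  semiInvariant := isSemiInvariant_domRestrict_iff.2 hA
  aestronglyMeasurable v := (continuous_orbit π A v).aestronglyMeasurable
  squareBounded := hQ

/-- The wavelet transform `v ↦ (g ↦ A π(g⁻¹) v)` of a bounded operator `A`, on the whole space
of `π`. -/
noncomputable def waveletTransform (hA : IsSemiInvariantOperator π σ A)
    (hQ : IsSquareBounded θ (A.toLinearMap.domRestrict (π.garding μG))) : E →L[ℂ] Ind μG θ σ :=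
  LinearMap.mkContinuousOfExistsBound
    { toFun := fun v => (hA.isInduced_orbit hQ v).toInd
      map_add' := fun u v =>
        IsInduced.toInd_congr _ ((hA.isInduced_orbit hQ u).add (hA.isInduced_orbit hQ v))
          (by ext g; simp)
      map_smul' := fun c v =>
        IsInduced.toInd_congr _ ((hA.isInduced_orbit hQ v).smul c) (by ext g; simp) } <| by
    obtain ⟨β, hβ0, hβ⟩ := hQ
    refine ⟨√β, fun v => ?_⟩
    have hle := (hA.isInduced_orbit ⟨β, hβ0, hβ⟩ v).ofReal_norm_toInd_sq.trans_le
      (lintegral_orbit_le hβ v)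
    rw [ENNReal.ofReal_le_ofReal_iff (by positivity)] at hle
    refine (sq_le_sq₀ (norm_nonneg _) (by positivity)).1 ?_
    rwa [mul_pow, Real.sq_sqrt hβ0.le]

theorem waveletTransform_apply (hA : IsSemiInvariantOperator π σ A)
    (hQ : IsSquareBounded θ (A.toLinearMap.domRestrict (π.garding μG))) (v : E) :
    hA.waveletTransform hQ v = (hA.isInduced_orbit hQ v).toInd :=
  rfl

theorem isWaveletTransform_waveletTransform (hA : IsSemiInvariantOperator π σ A)
    (hQ : IsSquareBounded θ (A.toLinearMap.domRestrict (π.garding μG))) :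
    IsWaveletTransform (A.toLinearMap.domRestrict (π.garding μG)) (hA.waveletTransform hQ) :=
  fun v => ⟨hA.isInduced_orbit hQ v, rfl⟩

theorem ofReal_norm_waveletTransform_sq (hA : IsSemiInvariantOperator π σ A)
    (hQ : IsSquareBounded θ (A.toLinearMap.domRestrict (π.garding μG))) (v : E) :
    ENNReal.ofReal (‖hA.waveletTransform hQ v‖ ^ 2) =
      ∫⁻ g, ‖A (π g⁻¹ v)‖ₑ ^ 2 ∂(thetaMeasure μG θ) :=
  (hA.isInduced_orbit hQ v).ofReal_norm_toInd_sq

theorem exists_mul_sq_norm_le_sq_norm_waveletTransform (hA : IsSemiInvariantOperator π σ A)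
    (hF : IsFrame θ (A.toLinearMap.domRestrict (π.garding μG))) :
    ∃ α > 0, ∀ v, α * ‖v‖ ^ 2 ≤ ‖hA.waveletTransform hF.isSquareBounded v‖ ^ 2 := by
  have ⟨α, _, hα, _, hαβ⟩ := hF
  refine ⟨α, hα, fun v => ?_⟩
  have hclosed : IsClosed {v : E | α * ‖v‖ ^ 2 ≤
      ‖hA.waveletTransform hF.isSquareBounded v‖ ^ 2} :=
    isClosed_le (by fun_prop) (by fun_prop)
  refine hclosed.closure_subset_iff.2 (fun u hu => ?_) (π.dense_garding μG v)
  rw [Set.mem_ofPred_eq, ← ENNReal.ofReal_le_ofReal_iff (by positivity),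
    hA.ofReal_norm_waveletTransform_sq]
  exact (hαβ ⟨u, hu⟩).1

theorem norm_waveletTransform_of_isTightFrame (hA : IsSemiInvariantOperator π σ A)
    (hT : IsTightFrame θ (A.toLinearMap.domRestrict (π.garding μG))) (v : E) :
    ‖hA.waveletTransform hT.isFrame.isSquareBounded v‖ = ‖v‖ := by
  refine congr_fun (Continuous.ext_on (π.dense_garding μG)
    (hA.waveletTransform hT.isFrame.isSquareBounded).continuous.norm continuous_norm
    fun u hu => ?_) v
  rw [← sq_eq_sq₀ (norm_nonneg _) (norm_nonneg _),
    ← ENNReal.ofReal_eq_ofReal_iff (by positivity) (by positivity),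
    hA.ofReal_norm_waveletTransform_sq]
  exact hT ⟨u, hu⟩

variable [T2Space G] [μH.IsHaarMeasure]

theorem waveletTransform_intertwines (hA : IsSemiInvariantOperator π σ A)
    (hQ : IsSquareBounded θ (A.toLinearMap.domRestrict (π.garding μG))) (hθ : IsTheta H μH θ)
    (g : G) (v : E) :
    hA.waveletTransform hQ (π g v) = ind σ hθ g (hA.waveletTransform hQ v) := by
  have hind : ind σ hθ g (hA.isInduced_orbit hQ v).toInd =
      ((hA.isInduced_orbit hQ v).translate hθ g).toInd := indIsometry_toInd hθ g _
  rw [waveletTransform_apply, waveletTransform_apply, hind]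
  refine IsInduced.toInd_congr _ _ (funext fun x => ?_)
  rw [mul_inv_rev, inv_inv, π.mul_apply]

theorem exists_isTightFrame_comp (hA : IsSemiInvariantOperator π σ A) (hθ : IsTheta H μH θ)
    (hF : IsFrame θ (A.toLinearMap.domRestrict (π.garding μG))) :
    ∃ T : E →L[ℂ] E, (∀ g v, T (π g v) = π g (T v)) ∧
      IsTightFrame θ ((A ∘L T).toLinearMap.domRestrict (π.garding μG)) := by
  obtain ⟨α, hα, hlow⟩ := hA.exists_mul_sq_norm_le_sq_norm_waveletTransform hF
  obtain ⟨T, hT, hTU⟩ := exists_norm_comp_eq_of_bounded_below hα hlow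
  have hTπ (g : G) (v : E) : T (π g v) = π g (T v) := hTU (π g) (fun u => by
    rw [hA.waveletTransform_intertwines _ hθ, LinearIsometryEquiv.norm_map]) v
  refine ⟨T, hTπ, fun v => ?_⟩
  simp only [energy_domRestrict, ContinuousLinearMap.comp_apply, hTπ]
  rw [← hA.ofReal_norm_waveletTransform_sq hF.isSquareBounded, hT, Submodule.coe_norm]

theorem isSquareIntegrableMod_of_isTightFrame (hA : IsSemiInvariantOperator π σ A)
    (hθ : IsTheta H μH θ) (hT : IsTightFrame θ (A.toLinearMap.domRestrict (π.garding μG))) :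
    IsSquareIntegrableMod μG π σ hθ := by
  have hQ := hT.isFrame.isSquareBounded
  have hadm := hA.isAdmissible_domRestrict hQ
  exact
    { subrep := ⟨⟨(hA.waveletTransform hQ).toLinearMap,
        hA.norm_waveletTransform_of_isTightFrame hT⟩, hA.waveletTransform_intertwines hQ hθ⟩
      tight := ⟨_, hadm, hT⟩
      frame := ⟨_, hadm, hT.isFrame⟩ }

theorem isSquareIntegrableMod_of_isFrame (hA : IsSemiInvariantOperator π σ A)
    (hθ : IsTheta H μH θ) (hF : IsFrame θ (A.toLinearMap.domRestrict (π.garding μG))) :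
    IsSquareIntegrableMod μG π σ hθ := by
  obtain ⟨T, hTπ, hT⟩ := hA.exists_isTightFrame_comp hθ hF
  exact (hA.comp hTπ).isSquareIntegrableMod_of_isTightFrame hθ hT

end IsSemiInvariantOperator

end Wavelet

end SqIntModSubgroup

open SqIntModSubgroup in
theorem mainTheorem6_general
    {G : Type*} [Group G] [TopologicalSpace G] [IsTopologicalGroup G] [LocallyCompactSpace G]
    [SecondCountableTopology G] [T2Space G] [MeasurableSpace G] [BorelSpace G]
    (H : Subgroup G) (hH : IsClosed (H : Set G)) [LocallyCompactSpace H]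
    (μG : Measure G) [μG.IsHaarMeasure] (μH : Measure H) [μH.IsHaarMeasure]
    {E : Type*} [NormedAddCommGroup E] [InnerProductSpace ℂ E] [CompleteSpace E]
    {K : Type*} [NormedAddCommGroup K] [InnerProductSpace ℂ K]
    (π : UnitaryRep G E) (σ : UnitaryRep H K)
    (A : E →L[ℂ] K)
    (hA : IsSemiInvariant σ (A.toLinearMap.domRestrict (π.garding μG))) :
    (A ≠ 0 →
      (∃ ν : Measure (G ⧸ H), ν ≠ 0 ∧ IsFiniteMeasureOnCompacts ν ∧
        SMulInvariantMeasure G (G ⧸ H) ν) ∧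
      ∀ h : H, modFun (h : G) = modFun h) ∧
    ∀ (θ : G → ℝ) (hθ : IsTheta H μH θ),
      (IsSquareBounded θ (A.toLinearMap.domRestrict (π.garding μG)) →
        IsAdmissible θ σ (A.toLinearMap.domRestrict (π.garding μG)) ∧
        ∃ W : E →L[ℂ] Ind μG θ σ,
          IsWaveletTransform (A.toLinearMap.domRestrict (π.garding μG)) W ∧
          (∀ W' : E →L[ℂ] Ind μG θ σ,
            IsWaveletTransform (A.toLinearMap.domRestrict (π.garding μG)) W' →
              W' = W) ∧
          (∀ (g : G) (v : E), W (π g v) = ind σ hθ g (W v)) ∧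
          ∀ v : E, (Continuous fun g : G => A (π g⁻¹ v)) ∧
            ∃ hF : IsInduced μG θ σ (fun g => A (π g⁻¹ v)), W v = hF.toInd) ∧
      (IsFrame θ (A.toLinearMap.domRestrict (π.garding μG)) →
        IsSquareIntegrableMod μG π σ hθ ∧
        IsSquareIntegrableMod μG π (π.restrict H) hθ) := by
  have hS : IsSemiInvariantOperator π σ A := isSemiInvariant_domRestrict_iff.1 hA
  refine ⟨fun hA0 => ?_, fun θ hθ => ⟨fun hQ => ?_, fun hF => ⟨?_, ?_⟩⟩⟩
  · have hΔ (h : H) : modFun (h : G) = modFun h :=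
      (modRatio_eq_one_iff h).1 (hS.modRatio_eq_one hA0 h)
    exact ⟨exists_invariant_measure_quotient hH hΔ, hΔ⟩
  · exact ⟨hS.isAdmissible_domRestrict hQ, hS.waveletTransform hQ,
      hS.isWaveletTransform_waveletTransform hQ,
      fun W' hW' => hW'.unique (hS.isWaveletTransform_waveletTransform hQ),
      hS.waveletTransform_intertwines hQ hθ,
      fun v => ⟨continuous_orbit π A v, hS.isInduced_orbit hQ v, hS.waveletTransform_apply hQ v⟩⟩
  · exact hS.isSquareIntegrableMod_of_isFrame hθ hF
  · exact hS.absValue.isSquareIntegrableMod_of_isFrame hθ hF.domRestrict_absValue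

theorem mainTheorem6
    {G : Type*} [Group G] [TopologicalSpace G] [IsTopologicalGroup G] [LocallyCompactSpace G]
    [SecondCountableTopology G] [T2Space G] [MeasurableSpace G] [BorelSpace G]
    (H : Subgroup G) (_hH : IsClosed (H : Set G)) [LocallyCompactSpace H]
    (μG : Measure G) [μG.IsHaarMeasure] (μH : Measure H) [μH.IsHaarMeasure]
    {E : Type*} [NormedAddCommGroup E] [InnerProductSpace ℂ E] [CompleteSpace E]
    [TopologicalSpace.SeparableSpace E]
    {K : Type*} [NormedAddCommGroup K] [InnerProductSpace ℂ K] [CompleteSpace K]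
    [TopologicalSpace.SeparableSpace K]
    (π : SqIntModSubgroup.UnitaryRep G E) (σ : SqIntModSubgroup.UnitaryRep H K)
    (A : E →L[ℂ] K)
    (_hA : SqIntModSubgroup.IsSemiInvariant σ (A.toLinearMap.domRestrict (π.garding μG))) :
    (A ≠ 0 →
      (∃ ν : Measure (G ⧸ H), ν ≠ 0 ∧ IsFiniteMeasureOnCompacts ν ∧
        SMulInvariantMeasure G (G ⧸ H) ν) ∧
      ∀ h : H, SqIntModSubgroup.modFun (h : G) = SqIntModSubgroup.modFun h) ∧
    ∀ (θ : G → ℝ) (hθ : SqIntModSubgroup.IsTheta H μH θ),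
      (SqIntModSubgroup.IsSquareBounded θ (A.toLinearMap.domRestrict (π.garding μG)) →
        SqIntModSubgroup.IsAdmissible θ σ (A.toLinearMap.domRestrict (π.garding μG)) ∧
        ∃ W : E →L[ℂ] SqIntModSubgroup.Ind μG θ σ,
          SqIntModSubgroup.IsWaveletTransform (A.toLinearMap.domRestrict (π.garding μG)) W ∧
          (∀ W' : E →L[ℂ] SqIntModSubgroup.Ind μG θ σ,
            SqIntModSubgroup.IsWaveletTransform (A.toLinearMap.domRestrict (π.garding μG)) W' →
              W' = W) ∧
          (∀ (g : G) (v : E), W (π g v) = SqIntModSubgroup.ind σ hθ g (W v)) ∧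
          ∀ v : E, (Continuous fun g : G => A (π g⁻¹ v)) ∧
            ∃ hF : SqIntModSubgroup.IsInduced μG θ σ (fun g => A (π g⁻¹ v)), W v = hF.toInd) ∧
      (SqIntModSubgroup.IsFrame θ (A.toLinearMap.domRestrict (π.garding μG)) →
        SqIntModSubgroup.IsSquareIntegrableMod μG π σ hθ ∧
        SqIntModSubgroup.IsSquareIntegrableMod μG π (π.restrict H) hθ) :=
  mainTheorem6_general H _hH μG μH π σ A _hA
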